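/- A bipartite (pure) quantum state is a triple $(|\psi\rangle,\mathcal H_A,\mathcal H_B)$, where $\mathcal H_A,\mathcal H_B$ are finite-dimensional complex Hilbert spaces (which we may take to be $\mathbb C^a,\mathbb C^b$) and $|\psi\rangle\in\mathcal H_A\otimes\mathcal H_B$ is a unit vector up to global phase. Let $\mathcal B$ be the set of all of them, and let $|\psi\rangle\otimes|\eta\rangle$ denote composition of bipartite states, where both of Alice's systems and both of Bob's systems are grouped together: for $|\psi\rangle\in\mathcal H_A\otimes\mathcal H_B$ and $|\eta\rangle\in\mathcal H_C\otimes\mathcal H_D$ the result lies in $(\mathcal H_A\otimes\mathcal H_C)\otimes(\mathcal H_B\otimes\mathcal H_D)$. Write $|\psi\rangle\to_{LOCC}|\phi\rangle$ if some LOCC channel sends $|\psi\rangle\langle\psi|$ to $|\phi\rangle\langle\phi|$. Here a channel is LOCC if it is implemented by a protocol of finitely many rounds; in each round one of the two parties performs a local quantum measurement with finitely many outcomes (Kraus operators $K_m$ with $\sum_m K_m^\dagger K_m=I$), whose choice may depend on all earlier outcomes, and communicates the outcome to the other party. The dimensions of the local spaces may change during the protocol. Define $$Cat_{LOCC}=\{(A,B)\in\mathcal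 B\times\mathcal B:\ \exists\, C\in\mathcal B,\ A\otimes C\to_{LOCC}B\otimes C\},$$ and let $Cat_{LOCC}^{(fin)}$ be the set of all $(A,B)\in\mathcal B\times\mathcal B$ for which there is a nonempty finite set $S\subset\mathcal B$ such that for every $C\in S$ there is $C'\in S$ with $A\otimes C\to_{LOCC}B\otimes C'$. **Theorem.** $Cat_{LOCC}^{(fin)}=Cat_{LOCC}$. -/

import Mathlib

open scoped Kronecker

namespace FlexCat

noncomputable section

/-! ### Catalytic transformation classes

`T` is the set of states, `op` the composition of states, `le A B` means that `A` transforms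
into `B`. -/

/-- `Cat_T(C)`: transformations that are possible with the catalyst `C`. -/
def catWith {T : Type*} (op : T → T → T) (le : T → T → Prop) (C : T) : Set (T × T) :=
  {p | le (op p.1 C) (op p.2 C)}

/-- `Cat_T`: transformations that are possible with some catalyst. -/
def cat {T : Type*} (op : T → T → T) (le : T → T → Prop) : Set (T × T) :=
  ⋃ C : T, catWith op le C

/-- `Cat_T^(f)(S)`: transformations that are possible flexibly with the set of catalysts `S`. -/
def flexCatWith {T : Type*} (op : T → T → T) (le : T → T → Prop) (S : Set T) : Set (T × T) :=
  {p | ∀ C ∈ S, ∃ C' ∈ S, le (op p.1 C) (op p.2 C')}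

/-- `Cat_T^(fin)`: transformations that are possible flexibly with some nonempty finite set of
catalysts. -/
def finFlexCat {T : Type*} (op : T → T → T) (le : T → T → Prop) : Set (T × T) :=
  ⋃ S ∈ {S : Set T | S.Nonempty ∧ S.Finite}, flexCatWith op le S

/-! ### Pure states -/

/-- Unit vectors of the Hilbert space `ℂ^ι`. -/
def UnitVec (ι : Type) [Fintype ι] : Type := {v : EuclideanSpace ℂ ι // ‖v‖ = 1}

/-- Equality up to a global phase. -/
def phaseSetoid (ι : Type) [Fintype ι] : Setoid (UnitVec ι) where
  r v w := ∃ c : ℂ, ‖c‖ = 1 ∧ w.1 = c • v.1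
  iseqv :=
    { refl := fun v => ⟨1, by simp, by simp⟩
      symm := by
        rintro v w ⟨c, hc, h⟩
        have h0 : c ≠ 0 := by
          rintro rfl
          simp at hc
        exact ⟨c⁻¹, by simp [hc], by rw [h, smul_smul, inv_mul_cancel₀ h0, one_smul]⟩
      trans := by
        rintro u v w ⟨c, hc, h⟩ ⟨d, hd, h'⟩
        exact ⟨d * c, by simp [hc, hd], by rw [h', h, smul_smul]⟩ }

/-- Pure states of `ℂ^ι`: unit vectors up to a global phase. -/
def PureState (ι : Type) [Fintype ι] : Type := Quotient (phaseSetoid ι)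

/-- The density operator `|ψ⟩⟨ψ|`, with entries `ψ i * conj (ψ j)`. -/
def PureState.density {ι : Type} [Fintype ι] : PureState ι → Matrix ι ι ℂ :=
  Quotient.lift (fun v : UnitVec ι => Matrix.of fun i j => v.1 i * star (v.1 j)) (by
    rintro v w ⟨c, hc, h⟩
    ext i j
    have h1 : c * (starRingEnd ℂ) c = 1 := by
      rw [Complex.mul_conj, Complex.normSq_eq_norm_sq, hc]
      simp
    simp only [Matrix.of_apply, h, PiLp.smul_apply, smul_eq_mul, RCLike.star_def, map_mul]
    linear_combination (-(v.1 i * (starRingEnd ℂ) (v.1 j))) * h1)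

/-- A bipartite pure state: the local Hilbert spaces are `ℂ^dimA` and `ℂ^dimB`, and their tensor
product is identified with `ℂ^(dimA × dimB)` through the product basis. -/
structure BipartiteState where
  dimA : ℕ
  dimB : ℕ
  state : PureState (Fin dimA × Fin dimB)

/-- The vector `(I ⊗ SWAP ⊗ I) (v ⊗ w)` of `(ℂ^a ⊗ ℂ^c) ⊗ (ℂ^b ⊗ ℂ^d)`, for `v ∈ ℂ^a ⊗ ℂ^b` and
`w ∈ ℂ^c ⊗ ℂ^d`; the product basis of `ℂ^a ⊗ ℂ^c` is enumerated by `finProdFinEquiv`. -/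
def tensorVec {a b c d : ℕ} (v : EuclideanSpace ℂ (Fin a × Fin b))
    (w : EuclideanSpace ℂ (Fin c × Fin d)) :
    EuclideanSpace ℂ (Fin (a * c) × Fin (b * d)) :=
  WithLp.toLp 2 fun p =>
    v ((finProdFinEquiv.symm p.1).1, (finProdFinEquiv.symm p.2).1) *
      w ((finProdFinEquiv.symm p.1).2, (finProdFinEquiv.symm p.2).2)

theorem norm_tensorVec {a b c d : ℕ} (v : EuclideanSpace ℂ (Fin a × Fin b))
    (w : EuclideanSpace ℂ (Fin c × Fin d)) : ‖tensorVec v w‖ = ‖v‖ * ‖w‖ := by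
  have h : ‖tensorVec v w‖ ^ 2 = (‖v‖ * ‖w‖) ^ 2 := by
    rw [mul_pow, EuclideanSpace.norm_sq_eq, EuclideanSpace.norm_sq_eq, EuclideanSpace.norm_sq_eq,
      Finset.sum_mul_sum, ← Fintype.sum_prod_type']
    let e : (Fin a × Fin b) × (Fin c × Fin d) ≃ Fin (a * c) × Fin (b * d) :=
      (Equiv.prodProdProdComm _ _ _ _).trans (Equiv.prodCongr finProdFinEquiv finProdFinEquiv)
    rw [← e.sum_comp]
    refine Finset.sum_congr rfl fun p _ => ?_
    have hp : tensorVec v w (e p) = v p.1 * w p.2 := by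
      simp only [tensorVec, e, Equiv.trans_apply, Equiv.prodCongr_apply, Prod.map_fst,
        Prod.map_snd, Equiv.symm_apply_apply]
      rfl
    rw [hp, norm_mul, mul_pow]
  exact (pow_left_inj₀ (norm_nonneg _) (by positivity) two_ne_zero).1 h

/-- Composition of pure bipartite states on fixed spaces. -/
def PureState.tensor {a b c d : ℕ} :
    PureState (Fin a × Fin b) → PureState (Fin c × Fin d) →
      PureState (Fin (a * c) × Fin (b * d)) :=
  Quotient.map₂ (fun v w => ⟨tensorVec v.1 w.1, by rw [norm_tensorVec, v.2, w.2, one_mul]⟩) (by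
    rintro v v' ⟨x, hx, h⟩ w w' ⟨y, hy, h'⟩
    refine ⟨x * y, by simp [hx, hy], ?_⟩
    ext p
    simp only [tensorVec, h, h', PiLp.smul_apply, smul_eq_mul]
    ring)

/-- Composition of bipartite states: both of Alice's systems stay with Alice, and both of Bob's
with Bob. -/
def BipartiteState.tensor (ψ φ : BipartiteState) : BipartiteState :=
  ⟨ψ.dimA * φ.dimA, ψ.dimB * φ.dimB, ψ.state.tensor φ.state⟩

/-! ### LOCC -/

/-- The map `ρ ↦ K ρ K†`. -/
def conjBy {ι κ : Type} [Fintype ι] [Fintype κ] (K : Matrix κ ι ℂ) :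
    Matrix ι ι ℂ →ₗ[ℂ] Matrix κ κ ℂ where
  toFun ρ := K * ρ * K.conjTranspose
  map_add' ρ σ := by rw [Matrix.mul_add, Matrix.add_mul]
  map_smul' z ρ := by simp

/-- `IsLOCC x y a b Λ`: the linear map `Λ`, from operators on `ℂ^a ⊗ ℂ^b` to operators on
`ℂ^x ⊗ ℂ^y`, is implemented by a protocol of finitely many rounds of local quantum operations and
classical communication.

Either there is nothing left to do, or one of the two parties performs a local quantum measurement
with finitely many outcomes `m`, given by Kraus operators `K m` with `∑ m, (K m)† (K m) = 1`,
tells the outcome to the other party, and they continue with an LOCC protocol that may depend on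
`m`. The dimension of the measured system after the measurement may depend on `m`; a local channel
is a measurement whose outcome is ignored later, and likewise for general local instruments. -/
inductive IsLOCC (x y : ℕ) : (a b : ℕ) →
    (Matrix (Fin a × Fin b) (Fin a × Fin b) ℂ →ₗ[ℂ]
      Matrix (Fin x × Fin y) (Fin x × Fin y) ℂ) → Prop
  | done : IsLOCC x y x y LinearMap.id
  | alice (a b k : ℕ) (a' : Fin k → ℕ) (K : (m : Fin k) → Matrix (Fin (a' m)) (Fin a) ℂ)
      (Λ : (m : Fin k) → (Matrix (Fin (a' m) × Fin b) (Fin (a' m) × Fin b) ℂ →ₗ[ℂ]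
        Matrix (Fin x × Fin y) (Fin x × Fin y) ℂ))
      (hK : ∑ m, (K m).conjTranspose * K m = 1)
      (hΛ : ∀ m, IsLOCC x y (a' m) b (Λ m)) :
      IsLOCC x y a b (∑ m, (Λ m) ∘ₗ conjBy (K m ⊗ₖ (1 : Matrix (Fin b) (Fin b) ℂ)))
  | bob (a b k : ℕ) (b' : Fin k → ℕ) (K : (m : Fin k) → Matrix (Fin (b' m)) (Fin b) ℂ)
      (Λ : (m : Fin k) → (Matrix (Fin a × Fin (b' m)) (Fin a × Fin (b' m)) ℂ →ₗ[ℂ]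
        Matrix (Fin x × Fin y) (Fin x × Fin y) ℂ))
      (hK : ∑ m, (K m).conjTranspose * K m = 1)
      (hΛ : ∀ m, IsLOCC x y a (b' m) (Λ m)) :
      IsLOCC x y a b (∑ m, (Λ m) ∘ₗ conjBy ((1 : Matrix (Fin a) (Fin a) ℂ) ⊗ₖ K m))

/-- `ψ →_LOCC φ`: some LOCC channel sends `|ψ⟩⟨ψ|` to `|φ⟩⟨φ|`. -/
def LOCCTransforms (ψ φ : BipartiteState) : Prop :=
  ∃ Λ, IsLOCC φ.dimA φ.dimB ψ.dimA ψ.dimB Λ ∧ Λ ψ.state.density = φ.state.density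

end

end FlexCat

open scoped Kronecker

namespace FlexCat

noncomputable section

open Matrix
open scoped ComplexOrder

/-! ### Majorization -/

/-! By Nielsen's theorem (`loccTransforms_iff_majorized`), LOCC convertibility of pure states is
majorization of their squared Schmidt coefficients, and composing states multiplies these
coefficients. The theorem thus becomes a statement about probability vectors.

A single catalyst is a one-element set. Conversely, a finite flexible set gives a self-map `C ↦ C'`,
which permutes its nonempty set of periodic points. Let `D` have as Schmidt vector the uniform
direct sum of the Schmidt vectors of these points. Then `A ⊗ D` is a direct sum of blocks `A ⊗ C`,
each majorized by the block `B ⊗ C'`. The permutation hits every block of `B ⊗ D` exactly once and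
all weights agree, so `Majorized.mul_sigma` glues the blockwise majorizations into one for `D`.

For Nielsen's theorem, necessity rests on `KyFanBound`, which bounds sums of largest squared
singular values by duality with low-rank test matrices and is therefore easy to follow through a
branching protocol (`IsLOCC.exists_outer`). A mixture equal to a pure state has only components
proportional to it, and this closes the estimate. Sufficiency rests on Rado's theorem
(`Majorized.exists_weights`): the source vector is a convex combination of permutations of the
target vector, and the weights are the outcome probabilities of a one-way protocol
(`exists_isLOCC_of_convex`).

`Majorized` imposes no equality of totals; where that is needed, it comes from normalization. -/

/-- `Majorized x y`: every partial sum of `x` is at most a fractional partial sum of `y` with no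
more terms. -/
def Majorized {ι κ : Type*} [Fintype κ] (x : ι → ℝ) (y : κ → ℝ) : Prop :=
  ∀ s : Finset ι, ∃ q : κ → ℝ, (∀ i, 0 ≤ q i) ∧ (∀ i, q i ≤ 1) ∧ ∑ i, q i ≤ s.card ∧
    ∑ i ∈ s, x i ≤ ∑ i, q i * y i

theorem exists_equiv_antitone {ι : Type*} [Fintype ι] (y : ι → ℝ) :
    ∃ e : Fin (Fintype.card ι) ≃ ι, Antitone (y ∘ e) := by
  let f : Fin (Fintype.card ι) → ℝ := fun k => -y ((Fintype.equivFin ι).symm k)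
  refine ⟨(Tuple.sort f).trans (Fintype.equivFin ι).symm, fun i j h => ?_⟩
  have := Tuple.monotone_sort f h
  simpa [f] using this

/-- The threshold value `y k` decides: replacing `q` by the indicator of the first `k` indices moves
weight only from values at most `y k` to values at least `y k`. Any weight left over in the budget
helps because `y` is nonnegative. -/
theorem sum_mul_le_sum_top {n : ℕ} {y q : Fin n → ℝ} (hy : Antitone y) (hy0 : ∀ i, 0 ≤ y i)
    (hq0 : ∀ i, 0 ≤ q i) (hq1 : ∀ i, q i ≤ 1) {k : ℕ} (hk : ∑ i, q i ≤ k) :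
    ∑ i, q i * y i ≤ ∑ i : Fin n, if (i : ℕ) < k then y i else 0 := by
  obtain h | h := le_or_gt n k
  · refine Finset.sum_le_sum fun i _ => ?_
    rw [if_pos (by omega)]
    nlinarith [hy0 i, hq1 i]
  · have h1 : ∀ i : Fin n, q i * y i - (if (i : ℕ) < k then y i else 0) ≤
        (q i - if (i : ℕ) < k then 1 else 0) * y ⟨k, h⟩ := by
      intro i
      split_ifs with hi
      · have := hy (show i ≤ ⟨k, h⟩ from Fin.le_def.2 hi.le)
        nlinarith [hq1 i]
      · have := hy (show (⟨k, h⟩ : Fin n) ≤ i from Fin.le_def.2 (not_lt.1 hi))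
        nlinarith [hq0 i]
    have h2 := Finset.sum_le_sum fun i (_ : i ∈ Finset.univ) => h1 i
    rw [Finset.sum_sub_distrib, ← Finset.sum_mul, Finset.sum_sub_distrib] at h2
    have h3 : ∑ i : Fin n, (if (i : ℕ) < k then (1 : ℝ) else 0) = k := by
      rw [Finset.sum_boole, Fin.card_filter_val_lt, min_eq_right h.le]
    rw [h3] at h2
    nlinarith [hy0 ⟨k, h⟩]

/-- Abel summation as an induction: passing from `w n` to the smaller `w (n + 1)` in front of a
nonpositive partial sum only increases the bound. The full sum needs no sign. -/
theorem sum_mul_le_mul_sum_range {w d : ℕ → ℝ} {n : ℕ} (hw : ∀ k < n, w (k + 1) ≤ w k)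
    (hd : ∀ k < n, ∑ i ∈ Finset.range (k + 1), d i ≤ 0) :
    ∑ i ∈ Finset.range (n + 1), w i * d i ≤ w n * ∑ i ∈ Finset.range (n + 1), d i := by
  induction n with
  | zero => simp
  | succ n ih =>
    have h := ih (fun k hk => hw k (by omega)) fun k hk => hd k (by omega)
    rw [Finset.sum_range_succ, Finset.sum_range_succ d (n + 1)]
    nlinarith [hw n (by omega), hd n (by omega)]

/-- The vanishing total kills the boundary term of Abel summation, so the weights may have any sign.
-/
theorem sum_fin_mul_nonpos {n : ℕ} {w d : Fin n → ℝ} (hw : Antitone w)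
    (hd : ∀ k : ℕ, ∑ i : Fin n, (if (i : ℕ) < k then d i else 0) ≤ 0) (h0 : ∑ i, d i = 0) :
    ∑ i, w i * d i ≤ 0 := by
  obtain _ | n := n
  · simp
  let w' : ℕ → ℝ := fun k => if h : k < n + 1 then w ⟨k, h⟩ else 0
  let d' : ℕ → ℝ := fun k => if h : k < n + 1 then d ⟨k, h⟩ else 0
  have hw' : ∀ i : Fin (n + 1), w' i = w i := fun i => dif_pos i.2
  have hd' : ∀ i : Fin (n + 1), d' i = d i := fun i => dif_pos i.2
  have e1 : ∑ i, w i * d i = ∑ i ∈ Finset.range (n + 1), w' i * d' i := by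
    rw [Finset.sum_range]
    exact Finset.sum_congr rfl fun i _ => by rw [hw', hd']
  have e2 : ∑ i ∈ Finset.range (n + 1), d' i = 0 := by
    rw [Finset.sum_range, ← h0]
    exact Finset.sum_congr rfl fun i _ => by rw [hd']
  rw [e1]
  refine (sum_mul_le_mul_sum_range (fun k hk => ?_) fun k hk => ?_).trans_eq (by rw [e2, mul_zero])
  · simp only [w', dif_pos (show k + 1 < n + 1 by omega), dif_pos (show k < n + 1 by omega)]
    exact hw (Fin.le_def.2 (Nat.le_succ k))
  · refine le_trans (le_of_eq ?_) (hd (k + 1))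
    have : ∑ i : Fin (n + 1), (if (i : ℕ) < k + 1 then d i else 0) =
        ∑ i ∈ Finset.range (n + 1), if i < k + 1 then d' i else 0 := by
      rw [Finset.sum_range]
      exact Finset.sum_congr rfl fun i _ => by rw [hd']
    rw [this, ← Finset.sum_filter]
    congr 1
    ext i
    simp only [Finset.mem_range, Finset.mem_filter]
    omega

/-- Rearrangement: the permutation aligns the decreasing order of `y` with that of `w`. In that
order the partial sums of `x` are dominated by those of `y`, and Abel summation applies. This is the
support-function form of Rado's theorem. -/
theorem Majorized.exists_perm {ι : Type*} [Fintype ι] {x y : ι → ℝ} (h : Majorized x y)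
    (hy : ∀ i, 0 ≤ y i) (hxy : ∑ i, x i = ∑ i, y i) (w : ι → ℝ) :
    ∃ σ : Equiv.Perm ι, ∑ i, w i * x i ≤ ∑ i, w i * y (σ i) := by
  classical
  obtain ⟨e, he⟩ := exists_equiv_antitone w
  obtain ⟨g, hg⟩ := exists_equiv_antitone y
  refine ⟨e.symm.trans g, ?_⟩
  rw [← sub_nonpos, ← Finset.sum_sub_distrib, ← e.sum_comp]
  simp only [Equiv.trans_apply, Equiv.symm_apply_apply, ← mul_sub]
  refine sum_fin_mul_nonpos he (fun k => ?_) ?_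
  · obtain ⟨q, hq0, hq1, hq, hs⟩ := h ((Finset.univ.filter fun i : Fin _ => (i : ℕ) < k).map
      e.toEmbedding)
    have hcard : (((Finset.univ.filter fun i : Fin (Fintype.card ι) => (i : ℕ) < k).map
        e.toEmbedding).card : ℝ) ≤ k := by
      rw [Finset.card_map, Fin.card_filter_val_lt]
      exact_mod_cast min_le_right _ _
    rw [← g.sum_comp] at hq hs
    have := sum_mul_le_sum_top hg (fun i => hy (g i)) (fun i => hq0 (g i)) (fun i => hq1 (g i))
      (hq.trans hcard)
    rw [Finset.sum_map, Finset.sum_filter] at hs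
    have e3 : ∀ i : Fin (Fintype.card ι), (if (i : ℕ) < k then x (e i) - y (g i) else 0) =
        (if (i : ℕ) < k then x (e i) else 0) - if (i : ℕ) < k then y (g i) else 0 := by
      intro i
      split_ifs <;> simp
    simp only [e3, Finset.sum_sub_distrib, sub_nonpos]
    exact hs.trans this
  · rw [Finset.sum_sub_distrib, e.sum_comp, g.sum_comp, hxy, sub_self]

/-- Rado's theorem: a majorized vector is a convex combination of permutations. -/
theorem Majorized.exists_weights {ι : Type*} [Fintype ι] [DecidableEq ι] {x y : ι → ℝ}
    (h : Majorized x y) (hy : ∀ i, 0 ≤ y i) (hxy : ∑ i, x i = ∑ i, y i) :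
    ∃ p : Equiv.Perm ι → ℝ, (∀ σ, 0 ≤ p σ) ∧ ∑ σ, p σ = 1 ∧
      ∀ i, x i = ∑ σ, p σ * y (σ i) := by
  let L : (Equiv.Perm ι → ℝ) →ₗ[ℝ] (ι → ℝ) :=
    { toFun := fun p i => ∑ σ, p σ * y (σ i)
      map_add' := fun p q => by
        ext i
        simp [add_mul, Finset.sum_add_distrib]
      map_smul' := fun c p => by
        ext i
        simp [Finset.mul_sum, mul_assoc] }
  by_contra hcon
  have hx : x ∉ L '' stdSimplex ℝ (Equiv.Perm ι) := by
    rintro ⟨p, hp, rfl⟩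
    exact hcon ⟨p, hp.1, hp.2, fun i => rfl⟩
  have hcomp : IsCompact (L '' stdSimplex ℝ (Equiv.Perm ι)) :=
    (isCompact_stdSimplex ℝ _).image L.continuous_of_finiteDimensional
  -- A functional separating `x` from the hull of the permutations of `y` would contradict
  -- `exists_perm`, with the coordinates of the functional as weights.
  obtain ⟨f, u, hf, hu⟩ := geometric_hahn_banach_closed_point
    ((convex_stdSimplex ℝ _).linear_image L) hcomp.isClosed hx
  have hfs : ∀ z : ι → ℝ, f z = ∑ i, f (Pi.single i 1) * z i := by
    intro z
    conv_lhs => rw [← Finset.univ_sum_single z, map_sum]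
    refine Finset.sum_congr rfl fun i _ => ?_
    rw [show Pi.single i (z i) = z i • (Pi.single i 1 : ι → ℝ) by
      rw [← Pi.single_smul, smul_eq_mul, mul_one], map_smul, smul_eq_mul, mul_comm]
  obtain ⟨σ, hσ⟩ := h.exists_perm hy hxy fun i => f (Pi.single i 1)
  have h1 := hf _ ⟨Pi.single σ 1, single_mem_stdSimplex ℝ σ, rfl⟩
  have h2 : L (Pi.single σ 1) = fun i => y (σ i) := by
    ext i
    simp [L, Pi.single_apply]
  rw [h2, hfs] at h1
  rw [hfs] at hu
  linarith

/-- Padding by zeros puts both vectors on the same index type, as Rado's theorem requires. -/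
theorem Majorized.sumElim {ι κ : Type*} [Fintype ι] [Fintype κ] {x : ι → ℝ} {y : κ → ℝ}
    (h : Majorized x y) :
    Majorized (Sum.elim x fun _ : κ => 0) (Sum.elim (fun _ : ι => 0) y) := by
  classical
  intro s
  obtain ⟨q, hq0, hq1, hq, hs⟩ := h (Finset.univ.filter fun i => Sum.inl i ∈ s)
  refine ⟨Sum.elim (fun _ => 0) q, ?_, ?_, ?_, ?_⟩
  · rintro (i | i) <;> simp [hq0]
  · rintro (i | i) <;> simp [hq1]
  · simp only [Fintype.sum_sum_type, Sum.elim_inl, Sum.elim_inr, Finset.sum_const_zero, zero_add]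
    refine hq.trans ?_
    rw [← Finset.card_map Function.Embedding.inl]
    refine Nat.cast_le.2 (Finset.card_le_card fun i hi => ?_)
    obtain ⟨j, hj, rfl⟩ := Finset.mem_map.1 hi
    simpa using hj
  · refine le_trans (le_of_eq ?_) (hs.trans_eq ?_)
    · rw [← Finset.univ_inter s, ← Finset.sum_ite_mem, Fintype.sum_sum_type]
      simp [Finset.sum_filter]
    · simp

/-- Majorization of direct sums of products, matched along a permutation of the summands. -/
theorem Majorized.mul_sigma {ι κ τ : Type*} [Fintype ι] [Fintype κ] [Fintype τ] {σ : τ → Type*}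
    [∀ t, Fintype (σ t)] {x : ι → ℝ} {y : κ → ℝ} {z : ∀ t, σ t → ℝ} {c : ℝ} (hc : 0 ≤ c)
    (e : τ ≃ τ)
    (h : ∀ t, Majorized (fun p : ι × σ t => x p.1 * z t p.2)
      (fun p : κ × σ (e t) => y p.1 * z (e t) p.2)) :
    Majorized (fun p : ι × (Σ t, σ t) => x p.1 * (c * z p.2.1 p.2.2))
      (fun p : κ × (Σ t, σ t) => y p.1 * (c * z p.2.1 p.2.2)) := by
  classical
  have h' : ∀ t, Majorized (fun p : ι × σ (e.symm t) => x p.1 * z _ p.2)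
      (fun p : κ × σ t => y p.1 * z t p.2) := by
    intro t
    have := h (e.symm t)
    rwa [e.apply_symm_apply] at this
  intro s
  -- Cut `s` into slices over the summands; the slice over `e.symm t` is dominated within the
  -- summand `t`. Both the cardinalities and the partial sums add up over slices.
  choose q hq0 hq1 hq hs using fun t => h' t
    (Finset.univ.filter fun p : ι × σ (e.symm t) => (p.1, (⟨_, p.2⟩ : Σ t, σ t)) ∈ s)
  have key : ∀ f : ι × (Σ t, σ t) → ℝ, ∑ p ∈ s, f p = ∑ t, ∑ p ∈ Finset.univ.filter
      fun p : ι × σ (e.symm t) => (p.1, (⟨_, p.2⟩ : Σ t, σ t)) ∈ s, f (p.1, ⟨_, p.2⟩) := by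
    intro f
    rw [e.symm.sum_comp fun t => ∑ p ∈ Finset.univ.filter
      fun p : ι × σ t => (p.1, (⟨t, p.2⟩ : Σ t, σ t)) ∈ s, f (p.1, ⟨t, p.2⟩)]
    rw [← Finset.univ_inter s, ← Finset.sum_ite_mem, Fintype.sum_prod_type]
    simp only [Fintype.sum_sigma, Finset.sum_filter, Fintype.sum_prod_type, Finset.univ_inter]
    rw [Finset.sum_comm]
  have key2 : ∀ f : κ × (Σ t, σ t) → ℝ, ∑ p, f p = ∑ t, ∑ p : κ × σ t, f (p.1, ⟨t, p.2⟩) := by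
    intro f
    simp only [Fintype.sum_prod_type, Fintype.sum_sigma]
    rw [Finset.sum_comm]
  refine ⟨fun p => q p.2.1 (p.1, p.2.2), fun p => hq0 _ _, fun p => hq1 _ _, ?_, ?_⟩
  · rw [key2, Finset.cast_card, key]
    exact Finset.sum_le_sum fun t _ => (hq t).trans_eq (by simp)
  · rw [key2, key]
    refine Finset.sum_le_sum fun t _ => ?_
    have := mul_le_mul_of_nonneg_left (hs t) hc
    rw [Finset.mul_sum, Finset.mul_sum] at this
    refine le_trans (le_of_eq ?_) (this.trans_eq ?_) <;>
    exact Finset.sum_congr rfl fun p _ => by ring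

/-! ### Schmidt decompositions -/

section Schmidt

variable {α β ι κ : Type*} [DecidableEq ι] [DecidableEq κ]

/-- The diagonal projection onto the support of `x`. -/
def suppProj (x : ι → ℝ) : Matrix ι ι ℂ := diagonal fun i => if x i = 0 then 0 else 1

/-- The diagonal matrix of square roots of `x`. -/
def sqrtDiag (x : ι → ℝ) : Matrix ι ι ℂ := diagonal fun i => (Real.sqrt (x i) : ℂ)

/-- The diagonal matrix of inverse square roots of `x`. -/
def invSqrtDiag (x : ι → ℝ) : Matrix ι ι ℂ := diagonal fun i => ((Real.sqrt (x i))⁻¹ : ℂ)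

theorem conjTranspose_suppProj (x : ι → ℝ) : (suppProj x)ᴴ = suppProj x := by
  rw [suppProj, diagonal_conjTranspose]
  congr 1
  ext i
  rw [Pi.star_apply]
  split_ifs <;> simp

theorem transpose_suppProj (x : ι → ℝ) : (suppProj x)ᵀ = suppProj x := diagonal_transpose _

theorem conjTranspose_sqrtDiag (x : ι → ℝ) : (sqrtDiag x)ᴴ = sqrtDiag x := by
  rw [sqrtDiag, diagonal_conjTranspose]
  congr 1
  ext i
  simp

theorem transpose_sqrtDiag (x : ι → ℝ) : (sqrtDiag x)ᵀ = sqrtDiag x := diagonal_transpose _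

theorem conjTranspose_invSqrtDiag (x : ι → ℝ) : (invSqrtDiag x)ᴴ = invSqrtDiag x := by
  rw [invSqrtDiag, diagonal_conjTranspose]
  congr 1
  ext i
  simp

/-- `x` is the vector of squared Schmidt coefficients of `M`, padded by zeros: `M` is
`∑ i, √(x i) u_i v_iᵀ`, where the `u_i` and `v_i` with `x i ≠ 0` are orthonormal families, and the
other ones vanish. -/
def HasSchmidt [Fintype α] [Fintype β] [Fintype ι] (M : Matrix α β ℂ) (x : ι → ℝ) : Prop :=
  (∀ i, 0 ≤ x i) ∧ ∃ (U : Matrix α ι ℂ) (V : Matrix β ι ℂ), Uᴴ * U = suppProj x ∧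
    Vᴴ * V = suppProj x ∧ M = U * sqrtDiag x * Vᵀ

variable [Fintype α] [Fintype β] [Fintype ι] [Fintype κ]

theorem suppProj_mul_self (x : ι → ℝ) : suppProj x * suppProj x = suppProj x := by
  rw [suppProj, diagonal_mul_diagonal]
  congr 1
  ext i
  split_ifs <;> simp

theorem sqrtDiag_mul_suppProj (x : ι → ℝ) : sqrtDiag x * suppProj x = sqrtDiag x := by
  rw [suppProj, sqrtDiag, diagonal_mul_diagonal]
  congr 1
  ext i
  split_ifs with h <;> simp [h]

theorem suppProj_mul_sqrtDiag (x : ι → ℝ) : suppProj x * sqrtDiag x = sqrtDiag x := by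
  rw [suppProj, sqrtDiag, diagonal_mul_diagonal]
  congr 1
  ext i
  split_ifs with h <;> simp [h]

theorem sqrtDiag_mul_self {x : ι → ℝ} (hx : ∀ i, 0 ≤ x i) :
    sqrtDiag x * sqrtDiag x = diagonal fun i => (x i : ℂ) := by
  rw [sqrtDiag, diagonal_mul_diagonal]
  congr 1
  ext i
  rw [← Complex.ofReal_mul, Real.mul_self_sqrt (hx i)]

theorem invSqrtDiag_mul_sqrtDiag {x : ι → ℝ} (hx : ∀ i, 0 ≤ x i) :
    invSqrtDiag x * sqrtDiag x = suppProj x := by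
  rw [suppProj, invSqrtDiag, sqrtDiag, diagonal_mul_diagonal]
  congr 1
  ext i
  split_ifs with h
  · simp [h]
  · have : (Real.sqrt (x i) : ℂ) ≠ 0 :=
      Complex.ofReal_ne_zero.2 (Real.sqrt_ne_zero'.2 ((hx i).lt_of_ne' h))
    rw [inv_mul_cancel₀ this]

theorem sqrtDiag_mul_invSqrtDiag {x : ι → ℝ} (hx : ∀ i, 0 ≤ x i) :
    sqrtDiag x * invSqrtDiag x = suppProj x := by
  rw [← invSqrtDiag_mul_sqrtDiag hx, sqrtDiag, invSqrtDiag, diagonal_mul_diagonal,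
    diagonal_mul_diagonal]
  simp only [mul_comm]

/-- A matrix whose Gram matrix is `suppProj x` is supported there. -/
theorem mul_suppProj_of_gram {U : Matrix α ι ℂ} {x : ι → ℝ} (h : Uᴴ * U = suppProj x) :
    U * suppProj x = U := by
  have h1 : (U * suppProj x - U)ᴴ * (U * suppProj x - U) = 0 := by
    rw [conjTranspose_sub, conjTranspose_mul, conjTranspose_suppProj]
    simp only [Matrix.sub_mul, Matrix.mul_sub, Matrix.mul_assoc, h, suppProj_mul_self]
    simp only [← Matrix.mul_assoc, h, suppProj_mul_self]
    simp
  exact sub_eq_zero.1 (conjTranspose_mul_self_eq_zero.1 h1)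

theorem mul_conjTranspose_mul_of_gram {U : Matrix α ι ℂ} {x : ι → ℝ} (h : Uᴴ * U = suppProj x) :
    U * Uᴴ * U = U := by
  rw [Matrix.mul_assoc, h, mul_suppProj_of_gram h]

/-- Singular value decomposition. -/
theorem exists_hasSchmidt [DecidableEq α] (M : Matrix α β ℂ) : ∃ x : α → ℝ, HasSchmidt M x := by
  have hA : (M * Mᴴ).PosSemidef := posSemidef_self_mul_conjTranspose M
  let x := hA.isHermitian.eigenvalues
  have hx : ∀ i, 0 ≤ x i := hA.eigenvalues_nonneg
  let Q : Matrix α α ℂ := hA.isHermitian.eigenvectorUnitary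
  have hQ : Qᴴ * Q = 1 := (mem_unitaryGroup_iff').1 hA.isHermitian.eigenvectorUnitary.2
  have hQ' : Q * Qᴴ = 1 := (mem_unitaryGroup_iff).1 hA.isHermitian.eigenvectorUnitary.2
  have hsp : M * Mᴴ = Q * (sqrtDiag x * sqrtDiag x) * Qᴴ := by
    have := hA.isHermitian.spectral_theorem
    rw [Unitary.conjStarAlgAut_apply] at this
    rw [sqrtDiag_mul_self hx]
    exact this
  have hD : Qᴴ * (M * Mᴴ) * Q = sqrtDiag x * sqrtDiag x := by
    rw [hsp]
    calc Qᴴ * (Q * (sqrtDiag x * sqrtDiag x) * Qᴴ) * Q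
        = (Qᴴ * Q) * (sqrtDiag x * sqrtDiag x) * (Qᴴ * Q) := by simp only [Matrix.mul_assoc]
      _ = _ := by rw [hQ, Matrix.one_mul, Matrix.mul_one]
  -- The rows of `W` are the right singular vectors, with zero rows where the eigenvalue vanishes.
  let W : Matrix α β ℂ := invSqrtDiag x * Qᴴ * M
  have hW : W * Wᴴ = suppProj x := by
    calc W * Wᴴ = invSqrtDiag x * (Qᴴ * (M * Mᴴ) * Q) * invSqrtDiag x := by
          simp only [W, conjTranspose_mul, conjTranspose_conjTranspose,
            conjTranspose_invSqrtDiag, Matrix.mul_assoc]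
      _ = (invSqrtDiag x * sqrtDiag x) * (sqrtDiag x * invSqrtDiag x) := by
          rw [hD]; simp only [Matrix.mul_assoc]
      _ = _ := by rw [invSqrtDiag_mul_sqrtDiag hx, sqrtDiag_mul_invSqrtDiag hx, suppProj_mul_self]
  -- The Gram matrix of the rows of `Qᴴ * M` is diagonal with entries `x i`, so rows off the support
  -- vanish and dividing by `√(x i)` loses nothing.
  have hS : suppProj x * (Qᴴ * M) = Qᴴ * M := by
    have h1 : (suppProj x * (Qᴴ * M) - Qᴴ * M) * (suppProj x * (Qᴴ * M) - Qᴴ * M)ᴴ = 0 := by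
      have e : (Qᴴ * M) * (Qᴴ * M)ᴴ = sqrtDiag x * sqrtDiag x := by
        rw [← hD, conjTranspose_mul, conjTranspose_conjTranspose]
        simp only [Matrix.mul_assoc]
      rw [conjTranspose_sub, conjTranspose_mul (suppProj x), conjTranspose_suppProj]
      generalize Qᴴ * M = Y at e
      have e1 : suppProj x * (Y * Yᴴ) = Y * Yᴴ := by
        rw [e, ← Matrix.mul_assoc, suppProj_mul_sqrtDiag]
      have e2 : (suppProj x * Y - Y) * Yᴴ = 0 := by
        rw [Matrix.sub_mul, Matrix.mul_assoc, e1, sub_self]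
      rw [Matrix.mul_sub, ← Matrix.mul_assoc, e2, Matrix.zero_mul, sub_zero]
    exact sub_eq_zero.1 (self_mul_conjTranspose_eq_zero.1 h1)
  refine ⟨x, hx, Q * suppProj x, Wᵀ, ?_, ?_, ?_⟩
  · rw [conjTranspose_mul, conjTranspose_suppProj, Matrix.mul_assoc, ← Matrix.mul_assoc Qᴴ, hQ,
      Matrix.one_mul, suppProj_mul_self]
  · have : (Wᵀ)ᴴ * Wᵀ = (W * Wᴴ)ᵀ := by
      rw [transpose_mul W Wᴴ]; rfl
    rw [this, hW, transpose_suppProj]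
  · rw [transpose_transpose]
    calc M = Q * Qᴴ * M := by rw [hQ', Matrix.one_mul]
      _ = Q * (suppProj x * (Qᴴ * M)) := by rw [hS, Matrix.mul_assoc]
      _ = Q * (suppProj x * ((sqrtDiag x * invSqrtDiag x) * (Qᴴ * M))) := by
          rw [sqrtDiag_mul_invSqrtDiag hx, hS, hS]
      _ = _ := by simp only [W, Matrix.mul_assoc]

theorem HasSchmidt.comp_equiv {M : Matrix α β ℂ} {x : ι → ℝ} (h : HasSchmidt M x) (e : κ ≃ ι) :
    HasSchmidt M (x ∘ e) := by
  obtain ⟨hx, U, V, hU, hV, rfl⟩ := h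
  have hs : suppProj (x ∘ e) = (suppProj x).submatrix e e := by
    rw [suppProj, suppProj, submatrix_diagonal_equiv]
    rfl
  have hq : sqrtDiag (x ∘ e) = (sqrtDiag x).submatrix e e := by
    rw [sqrtDiag, sqrtDiag, submatrix_diagonal_equiv]
    rfl
  refine ⟨fun i => hx _, U.submatrix id e, V.submatrix id e, ?_, ?_, ?_⟩
  · rw [hs, ← hU, conjTranspose_submatrix, ← submatrix_mul _ _ _ _ _ Function.bijective_id]
  · rw [hs, ← hV, conjTranspose_submatrix, ← submatrix_mul _ _ _ _ _ Function.bijective_id]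
  · rw [hq, transpose_submatrix, ← submatrix_mul _ _ _ _ _ e.bijective,
      ← submatrix_mul _ _ _ _ _ e.bijective, submatrix_id_id]

theorem HasSchmidt.sumElim_zero {M : Matrix α β ℂ} {x : ι → ℝ} (h : HasSchmidt M x) :
    HasSchmidt M (Sum.elim x fun _ : κ => 0) := by
  obtain ⟨hx, U, V, hU, hV, rfl⟩ := h
  have hs : suppProj (Sum.elim x fun _ : κ => 0) = fromBlocks (suppProj x) 0 0 0 := by
    ext (i | i) (j | j) <;> simp [suppProj, diagonal_apply]
    congr
  have hq : sqrtDiag (Sum.elim x fun _ : κ => 0) = fromBlocks (sqrtDiag x) 0 0 0 := by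
    ext (i | i) (j | j) <;> simp [sqrtDiag, diagonal_apply]
  refine ⟨?_, fromCols U 0, fromCols V 0, ?_, ?_, ?_⟩
  · rintro (i | i) <;> simp [hx]
  · rw [hs, conjTranspose_fromCols_eq_fromRows_conjTranspose, fromRows_mul_fromCols, hU]
    simp
  · rw [hs, conjTranspose_fromCols_eq_fromRows_conjTranspose, fromRows_mul_fromCols, hV]
    simp
  · rw [hq, transpose_fromCols, fromCols_mul_fromBlocks, fromCols_mul_fromRows]
    simp

theorem HasSchmidt.zero_sumElim {M : Matrix α β ℂ} {x : ι → ℝ} (h : HasSchmidt M x) :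
    HasSchmidt M (Sum.elim (fun _ : κ => 0) x) := by
  have := (h.sumElim_zero (κ := κ)).comp_equiv (Equiv.sumComm κ ι)
  convert this using 1
  ext (i | i) <;> rfl

theorem HasSchmidt.kronecker {γ δ : Type*} [Fintype γ] [Fintype δ] {M : Matrix α β ℂ}
    {N : Matrix γ δ ℂ} {x : ι → ℝ} {y : κ → ℝ} (hM : HasSchmidt M x) (hN : HasSchmidt N y) :
    HasSchmidt (M ⊗ₖ N) (fun p : ι × κ => x p.1 * y p.2) := by
  obtain ⟨hx, U, V, hU, hV, rfl⟩ := hM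
  obtain ⟨hy, U', V', hU', hV', rfl⟩ := hN
  have hs : suppProj (fun p : ι × κ => x p.1 * y p.2) = suppProj x ⊗ₖ suppProj y := by
    rw [suppProj, suppProj, suppProj, diagonal_kronecker_diagonal]
    congr 1
    ext p
    by_cases h1 : x p.1 = 0 <;> by_cases h2 : y p.2 = 0 <;> simp [h1, h2]
  have hq : sqrtDiag (fun p : ι × κ => x p.1 * y p.2) = sqrtDiag x ⊗ₖ sqrtDiag y := by
    rw [sqrtDiag, sqrtDiag, sqrtDiag, diagonal_kronecker_diagonal]
    congr 1
    ext p
    rw [Real.sqrt_mul (hx _), Complex.ofReal_mul]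
  refine ⟨fun p => mul_nonneg (hx _) (hy _), U ⊗ₖ U', V ⊗ₖ V', ?_, ?_, ?_⟩
  · rw [conjTranspose_kronecker, ← mul_kronecker_mul, hU, hU', hs]
  · rw [conjTranspose_kronecker, ← mul_kronecker_mul, hV, hV', hs]
  · rw [hq, mul_kronecker_mul, mul_kronecker_mul, kroneckerMap_transpose]

theorem HasSchmidt.submatrix {γ δ : Type*} [Fintype γ] [Fintype δ] {M : Matrix α β ℂ}
    {x : ι → ℝ} (h : HasSchmidt M x) (e : γ ≃ α) (f : δ ≃ β) :
    HasSchmidt (M.submatrix e f) x := by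
  obtain ⟨hx, U, V, hU, hV, rfl⟩ := h
  refine ⟨hx, U.submatrix e id, V.submatrix f id, ?_, ?_, ?_⟩
  · rw [conjTranspose_submatrix, ← submatrix_mul _ _ _ _ _ e.bijective, hU, submatrix_id_id]
  · rw [conjTranspose_submatrix, ← submatrix_mul _ _ _ _ _ f.bijective, hV, submatrix_id_id]
  · rw [submatrix_mul _ _ _ id _ Function.bijective_id,
      submatrix_mul _ _ _ id _ Function.bijective_id, submatrix_id_id, transpose_submatrix]

theorem hasSchmidt_sqrtDiag {x : ι → ℝ} (hx : ∀ i, 0 ≤ x i) : HasSchmidt (sqrtDiag x) x :=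
  ⟨hx, suppProj x, suppProj x, by rw [conjTranspose_suppProj, suppProj_mul_self],
    by rw [conjTranspose_suppProj, suppProj_mul_self],
    by rw [transpose_suppProj, suppProj_mul_sqrtDiag, sqrtDiag_mul_suppProj]⟩

/-- The squared Schmidt coefficients sum up to the squared Frobenius norm. -/
theorem HasSchmidt.trace_eq {M : Matrix α β ℂ} {x : ι → ℝ} (h : HasSchmidt M x) :
    (Mᴴ * M).trace = ((∑ i, x i : ℝ) : ℂ) := by
  obtain ⟨hx, U, V, hU, hV, rfl⟩ := h
  have hV' : Vᵀ * Vᵀᴴ = suppProj x := by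
    have : Vᵀ * Vᵀᴴ = (Vᴴ * V)ᵀ := by rw [transpose_mul]; rfl
    rw [this, hV, transpose_suppProj]
  calc _ = (Vᵀᴴ * (sqrtDiag x * (Uᴴ * U) * sqrtDiag x * Vᵀ)).trace := by
        rw [conjTranspose_mul, conjTranspose_mul, conjTranspose_sqrtDiag]
        simp only [Matrix.mul_assoc]
    _ = (sqrtDiag x * sqrtDiag x).trace := by
        rw [trace_mul_comm, hU, sqrtDiag_mul_suppProj, Matrix.mul_assoc, hV', Matrix.mul_assoc,
          sqrtDiag_mul_suppProj]
    _ = _ := by rw [sqrtDiag_mul_self hx, trace_diagonal]; simp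

end Schmidt

/-! ### LOCC acting on pure states -/

/-- The operator `|M⟩⟨M|` of the vector with coefficient matrix `M`. -/
def outer {α β : Type*} (M : Matrix α β ℂ) : Matrix (α × β) (α × β) ℂ :=
  vecMulVec (fun i => M i.1 i.2) (star fun i => M i.1 i.2)

theorem outer_zero {α β : Type*} : outer (0 : Matrix α β ℂ) = 0 := by
  ext i j
  simp [outer, vecMulVec_apply]

theorem outer_smul {α β : Type*} (c : ℂ) (M : Matrix α β ℂ) :
    outer (c • M) = (c * star c) • outer M := by
  ext i j
  simp only [outer, vecMulVec_apply, Matrix.smul_apply, smul_eq_mul, Pi.star_apply, star_mul']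
  ring

theorem conjBy_outer {α β γ δ : Type} [Fintype α] [Fintype β] [Fintype γ] [Fintype δ]
    (K : Matrix (γ × δ) (α × β) ℂ) (M : Matrix α β ℂ) (N : Matrix γ δ ℂ)
    (h : K *ᵥ (fun i => M i.1 i.2) = fun i => N i.1 i.2) : conjBy K (outer M) = outer N := by
  simp only [conjBy, LinearMap.coe_mk, AddHom.coe_mk, outer]
  rw [mul_vecMulVec, vecMulVec_mul, ← star_mulVec, h]

theorem conjBy_kronecker_one_outer {α β γ : Type} [Fintype α] [Fintype β] [Fintype γ]
    [DecidableEq β] (K : Matrix γ α ℂ) (M : Matrix α β ℂ) :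
    conjBy (K ⊗ₖ (1 : Matrix β β ℂ)) (outer M) = outer (K * M) := by
  refine conjBy_outer _ _ _ ?_
  ext i
  simp [mulVec, dotProduct, Fintype.sum_prod_type, mul_apply, one_apply]

theorem conjBy_one_kronecker_outer {α β δ : Type} [Fintype α] [Fintype β] [Fintype δ]
    [DecidableEq α] (L : Matrix δ β ℂ) (M : Matrix α β ℂ) :
    conjBy ((1 : Matrix α α ℂ) ⊗ₖ L) (outer M) = outer (M * Lᵀ) := by
  refine conjBy_outer _ _ _ ?_
  ext i
  simp [mulVec, dotProduct, Fintype.sum_prod_type, mul_apply, one_apply, mul_comm]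

/-! ### LOCC implies majorization -/

/-- The squared Frobenius norm. -/
def frob {α β : Type*} [Fintype α] [Fintype β] (N : Matrix α β ℂ) : ℝ := (Nᴴ * N).trace.re

theorem frob_eq_sum {α β : Type*} [Fintype α] [Fintype β] (N : Matrix α β ℂ) :
    frob N = ∑ j, ∑ i, ‖N i j‖ ^ 2 := by
  simp only [frob, trace, diag_apply, mul_apply, conjTranspose_apply, Complex.re_sum]
  refine Finset.sum_congr rfl fun j _ => Finset.sum_congr rfl fun i _ => ?_
  rw [RCLike.star_def, ← Complex.normSq_eq_conj_mul_self, Complex.ofReal_re,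
    Complex.normSq_eq_norm_sq]

theorem frob_nonneg {α β : Type*} [Fintype α] [Fintype β] (N : Matrix α β ℂ) : 0 ≤ frob N := by
  rw [frob_eq_sum]
  positivity

theorem norm_trace_sq_le {α β : Type*} [Fintype α] [Fintype β] (N M : Matrix α β ℂ) :
    ‖(Nᴴ * M).trace‖ ^ 2 ≤ frob N * frob M := by
  have h : ‖(Nᴴ * M).trace‖ ≤ ∑ p : β × α, ‖N p.2 p.1‖ * ‖M p.2 p.1‖ := by
    simp only [trace, diag_apply, mul_apply, conjTranspose_apply]
    rw [← Fintype.sum_prod_type' fun j i => star (N i j) * M i j]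
    refine (norm_sum_le _ _).trans (Finset.sum_le_sum fun p _ => ?_)
    rw [norm_mul, norm_star]
  rw [frob_eq_sum, frob_eq_sum, ← Fintype.sum_prod_type' fun j i => ‖N i j‖ ^ 2,
    ← Fintype.sum_prod_type' fun j i => ‖M i j‖ ^ 2]
  exact (pow_le_pow_left₀ (norm_nonneg _) h 2).trans (Finset.sum_mul_sq_le_sq_mul_sq _ _ _)

/-- `KyFanBound k M c`: the sum of the `k` largest squared singular values of `M` is at most
`c`. -/
def KyFanBound {α β : Type*} [Fintype α] [Fintype β] (k : ℕ) (M : Matrix α β ℂ) (c : ℝ) : Prop :=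
  0 ≤ c ∧ ∀ N : Matrix α β ℂ, N.rank ≤ k → ‖(Nᴴ * M).trace‖ ^ 2 ≤ c * frob N

/-- The test matrix is measured along with the state: each branch map does not raise its rank, and
completeness preserves its norm and its overlap with `M`. The triangle inequality followed by
Cauchy–Schwarz over branches then adds up the constants. -/
theorem KyFanBound.of_family {α β τ : Type*} [Fintype α] [Fintype β] [Fintype τ] {γ δ : τ → Type*}
    [∀ m, Fintype (γ m)] [∀ m, Fintype (δ m)] {k : ℕ} {M : Matrix α β ℂ}
    {M' : ∀ m, Matrix (γ m) (δ m) ℂ} {c : τ → ℝ} (h : ∀ m, KyFanBound k (M' m) (c m))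
    (T : ∀ m, Matrix α β ℂ → Matrix (γ m) (δ m) ℂ) (hr : ∀ m N, (T m N).rank ≤ N.rank)
    (hM : ∀ N, (Nᴴ * M).trace = ∑ m, ((T m N)ᴴ * M' m).trace)
    (hN : ∀ N, (Nᴴ * N).trace = ∑ m, ((T m N)ᴴ * T m N).trace) :
    KyFanBound k M (∑ m, c m) := by
  refine ⟨Finset.sum_nonneg fun m _ => (h m).1, fun N hNk => ?_⟩
  rw [show frob N = ∑ m, frob (T m N) by rw [frob, hN, Complex.re_sum]; rfl, hM]
  refine (pow_le_pow_left₀ (norm_nonneg _) (norm_sum_le _ _) 2).trans ?_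
  exact Finset.sum_sq_le_sum_mul_sum_of_sq_le_mul _ (fun m _ => (h m).1)
    (fun m _ => frob_nonneg _) fun m _ => (h m).2 _ ((hr m N).trans hNk)

theorem KyFanBound.of_mul_left {α β τ : Type*} [Fintype α] [DecidableEq α] [Fintype β] [Fintype τ]
    {γ : τ → Type*} [∀ m, Fintype (γ m)] {k : ℕ} {M : Matrix α β ℂ}
    {K : ∀ m, Matrix (γ m) α ℂ} (hK : ∑ m, (K m)ᴴ * K m = 1) {c : τ → ℝ}
    (h : ∀ m, KyFanBound k (K m * M) (c m)) : KyFanBound k M (∑ m, c m) := by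
  have key : ∀ N M : Matrix α β ℂ, (Nᴴ * M).trace = ∑ m, ((K m * N)ᴴ * (K m * M)).trace := by
    intro N M
    calc (Nᴴ * M).trace = (Nᴴ * (∑ m, (K m)ᴴ * K m) * M).trace := by rw [hK, Matrix.mul_one]
      _ = _ := by
        rw [Matrix.mul_sum, Matrix.sum_mul, trace_sum]
        simp only [conjTranspose_mul, Matrix.mul_assoc]
  exact KyFanBound.of_family h (fun m N => K m * N) (fun m N => rank_mul_le_right _ _)
    (fun N => key N M) fun N => key N N

theorem KyFanBound.of_mul_right {α β τ : Type*} [Fintype α] [DecidableEq β] [Fintype β] [Fintype τ]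
    {δ : τ → Type*} [∀ m, Fintype (δ m)] {k : ℕ} {M : Matrix α β ℂ}
    {K : ∀ m, Matrix (δ m) β ℂ} (hK : ∑ m, (K m)ᴴ * K m = 1) {c : τ → ℝ}
    (h : ∀ m, KyFanBound k (M * (K m)ᵀ) (c m)) : KyFanBound k M (∑ m, c m) := by
  have hK' : ∑ m, (K m)ᵀ * (K m)ᵀᴴ = 1 := by
    rw [← transpose_one, ← hK, transpose_sum]
    refine Finset.sum_congr rfl fun m _ => ?_
    rw [transpose_mul]
    rfl
  have key : ∀ N M : Matrix α β ℂ, (Nᴴ * M).trace =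
      ∑ m, ((N * (K m)ᵀ)ᴴ * (M * (K m)ᵀ)).trace := by
    intro N M
    calc (Nᴴ * M).trace = (Nᴴ * M * (∑ m, (K m)ᵀ * (K m)ᵀᴴ)).trace := by
          rw [hK', Matrix.mul_one]
      _ = _ := by
        rw [Matrix.mul_sum, trace_sum]
        refine Finset.sum_congr rfl fun m _ => ?_
        rw [conjTranspose_mul, ← Matrix.mul_assoc, trace_mul_comm]
        simp only [Matrix.mul_assoc]
  exact KyFanBound.of_family h (fun m N => N * (K m)ᵀ) (fun m N => rank_mul_le_left _ _)
    (fun N => key N M) fun N => key N N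

/-- An LOCC protocol turns a pure state into a mixture of pure states, along which the Ky Fan
bounds are monotone. -/
theorem IsLOCC.exists_outer {x y a b : ℕ} {Λ} (h : IsLOCC x y a b Λ) :
    ∀ M : Matrix (Fin a) (Fin b) ℂ, ∃ (τ : Type) (_ : Fintype τ)
      (W : τ → Matrix (Fin x) (Fin y) ℂ), Λ (outer M) = ∑ l, outer (W l) ∧
        ∀ k (c : τ → ℝ), (∀ l, KyFanBound k (W l) (c l)) → KyFanBound k M (∑ l, c l) := by
  induction h with
  | done =>
    intro M
    exact ⟨Unit, inferInstance, fun _ => M, by simp, fun k c h => by simpa using h ()⟩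
  | alice a b k a' K Λ hK hΛ ih =>
    intro M
    choose τ hτ W hW hc using fun m => ih m (K m * M)
    refine ⟨Σ m, τ m, inferInstance, fun l => W l.1 l.2, ?_, fun k c h => ?_⟩
    · rw [Fintype.sum_sigma, LinearMap.sum_apply]
      refine Finset.sum_congr rfl fun m _ => ?_
      rw [← hW, ← conjBy_kronecker_one_outer]
      rfl
    · rw [Fintype.sum_sigma]
      exact KyFanBound.of_mul_left hK fun m => hc m k _ fun l => h ⟨m, l⟩
  | bob a b k b' K Λ hK hΛ ih =>
    intro M
    choose τ hτ W hW hc using fun m => ih m (M * (K m)ᵀ)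
    refine ⟨Σ m, τ m, inferInstance, fun l => W l.1 l.2, ?_, fun k c h => ?_⟩
    · rw [Fintype.sum_sigma, LinearMap.sum_apply]
      refine Finset.sum_congr rfl fun m _ => ?_
      rw [← hW, ← conjBy_one_kronecker_outer]
      rfl
    · rw [Fintype.sum_sigma]
      exact KyFanBound.of_mul_right hK fun m => hc m k _ fun l => h ⟨m, l⟩

theorem KyFanBound.smul {α β : Type*} [Fintype α] [Fintype β] {k : ℕ} {M : Matrix α β ℂ} {c : ℝ}
    (h : KyFanBound k M c) (z : ℂ) : KyFanBound k (z • M) (‖z‖ ^ 2 * c) := by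
  refine ⟨mul_nonneg (by positivity) h.1, fun N hN => ?_⟩
  rw [Matrix.mul_smul, trace_smul, norm_smul, mul_pow, mul_assoc]
  exact mul_le_mul_of_nonneg_left (h.2 N hN) (by positivity)

/-- If a mixture of pure states is pure, then every component is proportional to it. -/
theorem exists_smul_of_sum_outer {α β τ : Type*} [Fintype α] [Fintype β] [Fintype τ]
    {W : τ → Matrix α β ℂ} {M : Matrix α β ℂ} (hM : (Mᴴ * M).trace = 1)
    (h : ∑ l, outer (W l) = outer M) :
    ∃ z : τ → ℂ, (∀ l, W l = z l • M) ∧ ∑ l, ‖z l‖ ^ 2 = 1 := by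
  -- Expectation values in a vector `X` turn the operator identity into an identity between sums of
  -- squared overlaps.
  have quad : ∀ X Y : Matrix α β ℂ,
      (star fun i : α × β => X i.1 i.2) ⬝ᵥ (outer Y *ᵥ fun i => X i.1 i.2) =
        ((‖(Xᴴ * Y).trace‖ ^ 2 : ℝ) : ℂ) := by
    intro X Y
    have e : ∀ X Y : Matrix α β ℂ, (star fun i : α × β => X i.1 i.2) ⬝ᵥ (fun i => Y i.1 i.2) =
        (Xᴴ * Y).trace := by
      intro X Y
      simp only [dotProduct, trace, diag_apply, mul_apply, conjTranspose_apply, Pi.star_apply,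
        Fintype.sum_prod_type]
      exact Finset.sum_comm
    rw [outer, vecMulVec_mulVec, dotProduct_smul, e, e, Complex.ofReal_pow, ← Complex.mul_conj',
      ← RCLike.star_def, ← trace_conjTranspose, conjTranspose_mul, conjTranspose_conjTranspose]
    simp
  have hsum : ∀ X : Matrix α β ℂ, ∑ l, ‖(Xᴴ * W l).trace‖ ^ 2 = ‖(Xᴴ * M).trace‖ ^ 2 := by
    intro X
    have := congrArg (fun A => (star fun i : α × β => X i.1 i.2) ⬝ᵥ (A *ᵥ fun i => X i.1 i.2)) h
    simp only [quad, sum_mulVec, dotProduct_sum] at this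
    exact_mod_cast this
  refine ⟨fun l => (Mᴴ * W l).trace, fun l => ?_, by rw [hsum, hM]; simp⟩
  -- The part of `W l` orthogonal to `M`. The expectation of `outer M` in `X` vanishes, hence so
  -- does each nonnegative term of the mixture, including `l`; but the overlap of `X` with `W l` is
  -- the squared norm of `X`.
  set X := W l - (Mᴴ * W l).trace • M with hX
  have hMX : (Mᴴ * X).trace = 0 := by
    rw [hX, Matrix.mul_sub, trace_sub, Matrix.mul_smul, trace_smul, hM]
    simp
  have hXM : (Xᴴ * M).trace = 0 := by
    rw [← conjTranspose_conjTranspose M, ← conjTranspose_mul, trace_conjTranspose, hMX, star_zero]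
  have h0 : ‖(Xᴴ * W l).trace‖ ^ 2 = 0 := by
    refine (Finset.sum_eq_zero_iff_of_nonneg (f := fun l => ‖(Xᴴ * W l).trace‖ ^ 2)
      fun i _ => by positivity).1 ?_ l (Finset.mem_univ l)
    rw [hsum, hXM]
    simp
  have hXX : (Xᴴ * X).trace = 0 := by
    have e : (Xᴴ * X).trace = (Xᴴ * W l).trace := by
      conv_lhs => rw [hX]
      rw [← hX, Matrix.mul_sub, trace_sub, Matrix.mul_smul, trace_smul, hXM, smul_zero, sub_zero]
    rw [e]
    simpa using h0
  exact sub_eq_zero.1 (trace_conjTranspose_mul_self_eq_zero_iff.1 hXX)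

/-- A matrix factors through an isometry from a space whose dimension is its rank. -/
theorem exists_isometry_of_rank {α β : Type*} [Fintype α] [Fintype β]
    (N : Matrix α β ℂ) : ∃ E : Matrix α (Fin N.rank) ℂ, Eᴴ * E = 1 ∧ E * (Eᴴ * N) = N := by
  classical
  let S : Submodule ℂ (EuclideanSpace ℂ α) :=
    Submodule.span ℂ (Set.range fun j => WithLp.toLp 2 (N.col j))
  have hS : Module.finrank ℂ S = N.rank := by
    rw [rank_eq_finrank_span_cols]
    have : S = (Submodule.span ℂ (Set.range N.col)).map
        (WithLp.linearEquiv 2 ℂ (α → ℂ)).symm.toLinearMap := by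
      rw [Submodule.map_span, ← Set.range_comp]
      rfl
    rw [this]
    exact LinearEquiv.finrank_map_eq _ _
  let e := (stdOrthonormalBasis ℂ S).reindex (finCongr hS)
  refine ⟨of fun i j => (e j : EuclideanSpace ℂ α) i, ?_, ?_⟩
  · ext i j
    have := orthonormal_iff_ite.1 e.orthonormal i j
    rw [Submodule.coe_inner, PiLp.inner_apply] at this
    simpa [mul_apply, one_apply, mul_comm] using this
  · ext i j
    have hm : WithLp.toLp 2 (N.col j) ∈ S := Submodule.subset_span ⟨j, rfl⟩
    have := congrArg (fun v : S => (v : EuclideanSpace ℂ α) i) (e.sum_repr ⟨_, hm⟩)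
    simp only [Submodule.coe_sum, WithLp.ofLp_sum, Finset.sum_apply, Submodule.coe_smul,
      PiLp.smul_apply, e.repr_apply_apply, Submodule.coe_inner, PiLp.inner_apply] at this
    rw [mul_apply]
    refine Eq.trans (Finset.sum_congr rfl fun l _ => ?_) this
    simp only [mul_apply, of_apply, conjTranspose_apply, smul_eq_mul]
    rw [mul_comm]
    congr 1
    exact Finset.sum_congr rfl fun i _ => by simp [mul_comm]

theorem sum_norm_sq_col {α β : Type*} [Fintype α] [Fintype β] (Y : Matrix α β ℂ) (j : β) :
    ((∑ i, ‖Y i j‖ ^ 2 : ℝ) : ℂ) = (Yᴴ * Y) j j := by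
  rw [mul_apply, Complex.ofReal_sum]
  refine Finset.sum_congr rfl fun i _ => ?_
  rw [conjTranspose_apply, RCLike.star_def, Complex.ofReal_pow, Complex.conj_mul']

/-- Bessel's inequality for a partial isometry. -/
theorem sum_norm_sq_conjTranspose_mul_le {α γ ι : Type*} [Fintype α] [Fintype γ] [Fintype ι]
    {U : Matrix α ι ℂ} (hU : U * Uᴴ * U = U) (X : Matrix α γ ℂ) (j : γ) :
    ∑ i, ‖(Uᴴ * X) i j‖ ^ 2 ≤ ∑ i, ‖X i j‖ ^ 2 := by
  classical
  have hE : (1 - U * Uᴴ)ᴴ * (1 - U * Uᴴ) = 1 - U * Uᴴ := by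
    have : U * Uᴴ * (U * Uᴴ) = U * Uᴴ := by rw [← Matrix.mul_assoc, hU]
    rw [conjTranspose_sub, conjTranspose_mul, conjTranspose_conjTranspose, conjTranspose_one,
      Matrix.mul_sub, Matrix.sub_mul, Matrix.sub_mul, this]
    simp
  have h1 : ∑ i, ‖X i j‖ ^ 2 =
      ∑ i, ‖(Uᴴ * X) i j‖ ^ 2 + ∑ i, ‖((1 - U * Uᴴ : Matrix α α ℂ) * X) i j‖ ^ 2 := by
    rw [← Complex.ofReal_inj, Complex.ofReal_add, sum_norm_sq_col, sum_norm_sq_col, sum_norm_sq_col, ← Matrix.add_apply, conjTranspose_mul,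
      conjTranspose_mul, conjTranspose_conjTranspose, Matrix.mul_assoc,
      Matrix.mul_assoc Xᴴ, ← Matrix.mul_add, ← Matrix.mul_assoc U, ← Matrix.mul_assoc (_)ᴴ,
      hE, ← Matrix.add_mul, add_sub_cancel, Matrix.one_mul]
  rw [h1]
  exact le_add_of_nonneg_right (by positivity)

/-- Ky Fan's maximum principle. -/
theorem HasSchmidt.exists_kyFanBound {α β κ : Type*} [Fintype α] [Fintype β] [Fintype κ]
    [DecidableEq κ] {M : Matrix α β ℂ} {y : κ → ℝ} (h : HasSchmidt M y) (k : ℕ) :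
    ∃ q : κ → ℝ, (∀ i, 0 ≤ q i) ∧ (∀ i, q i ≤ 1) ∧ ∑ i, q i ≤ k ∧
      KyFanBound k M (∑ i, q i * y i) := by
  obtain ⟨hy, U, V, hU, hV, rfl⟩ := h
  obtain ⟨g, hg⟩ := exists_equiv_antitone y
  -- The indicator of `k` largest entries of `y`.
  let q : κ → ℝ := fun i => if (g.symm i : ℕ) < k then 1 else 0
  have hq0 : ∀ i, 0 ≤ q i := fun i => by
    simp only [q]
    split_ifs <;> norm_num
  refine ⟨q, hq0, fun i => ?_, ?_, Finset.sum_nonneg fun i _ => mul_nonneg (hq0 i) (hy i), ?_⟩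
  · simp only [q]
    split_ifs <;> norm_num
  · rw [← g.sum_comp]
    simp only [q, Equiv.symm_apply_apply]
    rw [Finset.sum_boole, Fin.card_filter_val_lt]
    exact_mod_cast min_le_right _ _
  intro N hN
  obtain ⟨E, hE, hEN⟩ := exists_isometry_of_rank N
  have hUU := mul_conjTranspose_mul_of_gram hU
  -- Compressing to the column space of `N` and using Cauchy–Schwarz leaves the squared norm of `Eᴴ
  -- * M`, which is `∑ p i * y i`. Bessel's inequality, for `E` and then for `U`, gives `p i ≤ 1`
  -- and `∑ p i ≤ rank N`.
  let p : κ → ℝ := fun i => ∑ j, ‖(Eᴴ * U) j i‖ ^ 2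
  have hV' : Vᵀ * Vᵀᴴ = suppProj y := by
    have : Vᵀ * Vᵀᴴ = (Vᴴ * V)ᵀ := by rw [transpose_mul]; rfl
    rw [this, hV, transpose_suppProj]
  have hp0 : ∀ i, 0 ≤ p i := fun i => by positivity
  have hp1 : ∀ i, p i ≤ 1 := by
    intro i
    refine (sum_norm_sq_conjTranspose_mul_le (by rw [Matrix.mul_assoc, hE, Matrix.mul_one]) U
      i).trans ?_
    have e : ((∑ j, ‖U j i‖ ^ 2 : ℝ) : ℂ) = (Uᴴ * U) i i := sum_norm_sq_col U i
    rw [hU, suppProj, diagonal_apply_eq] at e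
    split_ifs at e
    · rw [Complex.ofReal_eq_zero] at e
      rw [e]
      exact zero_le_one
    · rw [Complex.ofReal_eq_one] at e
      exact e.le
  have hpk : ∑ i, p i ≤ k := by
    have e : ∀ j, ∑ i, ‖E i j‖ ^ 2 = 1 := by
      intro j
      have : ((∑ i, ‖E i j‖ ^ 2 : ℝ) : ℂ) = (Eᴴ * E) j j := sum_norm_sq_col E j
      rw [hE, one_apply_eq] at this
      exact_mod_cast this
    have e2 : ∑ i, p i = ∑ j, ∑ i, ‖(Uᴴ * E) i j‖ ^ 2 := by
      rw [Finset.sum_comm]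
      refine Finset.sum_congr rfl fun i _ => Finset.sum_congr rfl fun j _ => ?_
      rw [← conjTranspose_conjTranspose E, ← conjTranspose_mul, conjTranspose_apply, norm_star,
        conjTranspose_conjTranspose]
    rw [e2]
    refine (Finset.sum_le_sum fun j _ =>
      (sum_norm_sq_conjTranspose_mul_le hUU E j).trans_eq (e j)).trans ?_
    simpa using hN
  have hfrob : frob (Eᴴ * (U * sqrtDiag y * Vᵀ)) = ∑ i, p i * y i := by
    have e : ((Eᴴ * (U * sqrtDiag y * Vᵀ))ᴴ * (Eᴴ * (U * sqrtDiag y * Vᵀ))).trace =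
        (((Eᴴ * U) * sqrtDiag y)ᴴ * ((Eᴴ * U) * sqrtDiag y)).trace := by
      calc _ = (Vᵀᴴ * (((Eᴴ * U) * sqrtDiag y)ᴴ * (((Eᴴ * U) * sqrtDiag y) * Vᵀ))).trace := by
            simp only [conjTranspose_mul, Matrix.mul_assoc]
        _ = (((Eᴴ * U) * sqrtDiag y)ᴴ * ((Eᴴ * U) * (sqrtDiag y * (Vᵀ * Vᵀᴴ)))).trace := by
            rw [trace_mul_comm]
            simp only [Matrix.mul_assoc]
        _ = _ := by
            rw [hV', sqrtDiag_mul_suppProj]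
    rw [frob, e]
    change frob _ = _
    rw [frob_eq_sum]
    refine Finset.sum_congr rfl fun i _ => ?_
    rw [Finset.sum_mul]
    refine Finset.sum_congr rfl fun j _ => ?_
    rw [sqrtDiag, mul_diagonal, norm_mul, mul_pow, Complex.norm_real, Real.norm_eq_abs, sq_abs,
      Real.sq_sqrt (hy i)]
  have hfN : frob (Eᴴ * N) = frob N := by
    rw [frob, frob]
    conv_rhs => rw [← hEN]
    rw [conjTranspose_mul E, Matrix.mul_assoc (Eᴴ * N)ᴴ, ← Matrix.mul_assoc Eᴴ E, hE,
      Matrix.one_mul]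
  have htr : (Nᴴ * (U * sqrtDiag y * Vᵀ)).trace =
      ((Eᴴ * N)ᴴ * (Eᴴ * (U * sqrtDiag y * Vᵀ))).trace := by
    conv_lhs => rw [← hEN]
    rw [conjTranspose_mul E, Matrix.mul_assoc]
  rw [htr]
  refine (norm_trace_sq_le _ _).trans ?_
  rw [hfN, hfrob, mul_comm]
  refine mul_le_mul_of_nonneg_right ?_ (frob_nonneg N)
  rw [← g.sum_comp, ← g.sum_comp]
  have := sum_mul_le_sum_top hg (fun i => hy (g i)) (fun i => hp0 (g i)) (fun i => hp1 (g i))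
    (by rwa [g.sum_comp])
  refine this.trans_eq (Finset.sum_congr rfl fun i _ => ?_)
  simp [q]

/-- The test matrix is `M` truncated to the Schmidt terms in `s`. Its squared norm and its overlap
with `M` both equal the partial sum `S`, so the bound reads `S ^ 2 ≤ c * S`; the condition `0 ≤ c`
covers `S = 0`. -/
theorem HasSchmidt.sum_le_of_kyFanBound {α β ι : Type*} [Fintype α] [Fintype β] [Fintype ι]
    [DecidableEq ι] {M : Matrix α β ℂ} {x : ι → ℝ} (h : HasSchmidt M x) (s : Finset ι) {c : ℝ}
    (hc : KyFanBound s.card M c) : ∑ i ∈ s, x i ≤ c := by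
  obtain ⟨hx, U, V, hU, hV, rfl⟩ := h
  let P : Matrix ι ι ℂ := diagonal fun i => if i ∈ s then 1 else 0
  have hPP : P * P = P := by
    simp only [P, diagonal_mul_diagonal]
    congr 1
    ext i
    split_ifs <;> simp
  have hPH : Pᴴ = P := by
    simp only [P, diagonal_conjTranspose]
    congr 1
    ext i
    rw [Pi.star_apply]
    split_ifs <;> simp
  have hPq : P * sqrtDiag x = sqrtDiag x * P := by
    simp only [P, sqrtDiag, diagonal_mul_diagonal, mul_comm]
  have hV' : Vᵀ * Vᵀᴴ = suppProj x := by
    have : Vᵀ * Vᵀᴴ = (Vᴴ * V)ᵀ := by rw [transpose_mul]; rfl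
    rw [this, hV, transpose_suppProj]
  let N := U * P * sqrtDiag x * Vᵀ
  have hrank : N.rank ≤ s.card := by
    refine (rank_mul_le_left _ _).trans ((rank_mul_le_left _ _).trans
      ((rank_mul_le_right _ _).trans ?_))
    rw [rank_diagonal, Fintype.card_subtype]
    refine Finset.card_le_card fun i hi => ?_
    simpa using hi
  have htr : ∀ Q : Matrix ι ι ℂ, Q * sqrtDiag x = sqrtDiag x * Q →
      ((U * P * sqrtDiag x * Vᵀ)ᴴ * (U * Q * sqrtDiag x * Vᵀ)).trace =
      (P * Q * (sqrtDiag x * sqrtDiag x)).trace := by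
    intro Q hQ
    calc _ = (Vᵀᴴ * (sqrtDiag x * (P * (Uᴴ * U) * Q * sqrtDiag x) * Vᵀ)).trace := by
          simp only [conjTranspose_mul, Matrix.mul_assoc, hPH, conjTranspose_sqrtDiag]
      _ = (P * (sqrtDiag x * suppProj x) * Q * (sqrtDiag x * suppProj x)).trace := by
          rw [trace_mul_comm, hU, Matrix.mul_assoc (sqrtDiag x * _), hV']
          simp only [← Matrix.mul_assoc, ← hPq]
      _ = (P * Q * (sqrtDiag x * sqrtDiag x)).trace := by
          rw [sqrtDiag_mul_suppProj, Matrix.mul_assoc P, ← hQ]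
          simp only [Matrix.mul_assoc]
  have hsum : (P * (sqrtDiag x * sqrtDiag x)).trace = ((∑ i ∈ s, x i : ℝ) : ℂ) := by
    rw [sqrtDiag_mul_self hx, diagonal_mul_diagonal, trace_diagonal, Complex.ofReal_sum]
    simp only [ite_mul, one_mul, zero_mul, Finset.sum_ite_mem, Finset.univ_inter]
  have h1 := htr 1 (by rw [Matrix.one_mul, Matrix.mul_one])
  rw [Matrix.mul_one, Matrix.mul_one, hsum] at h1
  have h2 := htr P hPq
  rw [hPP, hsum] at h2
  have h3 := hc.2 N hrank
  rw [frob, h2, h1, Complex.norm_real, Real.norm_eq_abs, sq_abs, Complex.ofReal_re, sq] at h3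
  obtain h0 | h0 := (Finset.sum_nonneg fun i (_ : i ∈ s) => hx i).eq_or_lt
  · rw [← h0]
    exact hc.1
  · exact le_of_mul_le_mul_right h3 h0

/-- One half of Nielsen's theorem: an LOCC transformation of pure states requires majorization. -/
theorem IsLOCC.majorized {x y a b : ℕ} {Λ} (h : IsLOCC x y a b Λ)
    {M : Matrix (Fin a) (Fin b) ℂ} {N : Matrix (Fin x) (Fin y) ℂ} (hN : (Nᴴ * N).trace = 1)
    (hΛ : Λ (outer M) = outer N) {ι κ : Type*} [Fintype ι] [Fintype κ] [DecidableEq ι]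
    [DecidableEq κ] {u : ι → ℝ} {v : κ → ℝ} (hu : HasSchmidt M u) (hv : HasSchmidt N v) :
    Majorized u v := by
  intro s
  obtain ⟨τ, hτ, W, hW, hc⟩ := h.exists_outer M
  obtain ⟨z, hz, hz1⟩ := exists_smul_of_sum_outer hN (hW.symm.trans hΛ)
  obtain ⟨q, hq0, hq1, hq, hb⟩ := hv.exists_kyFanBound s.card
  refine ⟨q, hq0, hq1, hq, hu.sum_le_of_kyFanBound s ?_⟩
  -- Each final branch is `z l • N`, so its Ky Fan bound is that of `N` scaled by the branch
  -- probability, and these probabilities sum to one.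
  have := hc s.card (fun l => ‖z l‖ ^ 2 * ∑ i, q i * v i) fun l => by
    rw [hz]
    exact hb.smul _
  rwa [← Finset.sum_mul, hz1, one_mul] at this

/-! ### Majorization implies LOCC -/

theorem IsLOCC.alice_fintype {x y a b : ℕ} {τ : Type*} [Fintype τ] {a' : τ → ℕ}
    {K : ∀ m, Matrix (Fin (a' m)) (Fin a) ℂ} (hK : ∑ m, (K m)ᴴ * K m = 1)
    {Λ : ∀ m, Matrix (Fin (a' m) × Fin b) (Fin (a' m) × Fin b) ℂ →ₗ[ℂ]
      Matrix (Fin x × Fin y) (Fin x × Fin y) ℂ} (hΛ : ∀ m, IsLOCC x y (a' m) b (Λ m)) :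
    IsLOCC x y a b (∑ m, (Λ m) ∘ₗ conjBy (K m ⊗ₖ (1 : Matrix (Fin b) (Fin b) ℂ))) := by
  let e := (Fintype.equivFin τ).symm
  have := IsLOCC.alice (x := x) (y := y) a b _ (fun m => a' (e m)) (fun m => K (e m))
    (fun m => Λ (e m)) (by rw [e.sum_comp fun m => (K m)ᴴ * K m, hK]) fun m => hΛ (e m)
  rwa [e.sum_comp fun m => (Λ m) ∘ₗ conjBy (K m ⊗ₖ (1 : Matrix (Fin b) (Fin b) ℂ))] at this

theorem IsLOCC.bob_fintype {x y a b : ℕ} {τ : Type*} [Fintype τ] {b' : τ → ℕ}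
    {K : ∀ m, Matrix (Fin (b' m)) (Fin b) ℂ} (hK : ∑ m, (K m)ᴴ * K m = 1)
    {Λ : ∀ m, Matrix (Fin a × Fin (b' m)) (Fin a × Fin (b' m)) ℂ →ₗ[ℂ]
      Matrix (Fin x × Fin y) (Fin x × Fin y) ℂ} (hΛ : ∀ m, IsLOCC x y a (b' m) (Λ m)) :
    IsLOCC x y a b (∑ m, (Λ m) ∘ₗ conjBy ((1 : Matrix (Fin a) (Fin a) ℂ) ⊗ₖ K m)) := by
  let e := (Fintype.equivFin τ).symm
  have := IsLOCC.bob (x := x) (y := y) a b _ (fun m => b' (e m)) (fun m => K (e m))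
    (fun m => Λ (e m)) (by rw [e.sum_comp fun m => (K m)ᴴ * K m, hK]) fun m => hΛ (e m)
  rwa [e.sum_comp fun m => (Λ m) ∘ₗ conjBy ((1 : Matrix (Fin a) (Fin a) ℂ) ⊗ₖ K m)] at this

/-- Kraus operators into a given nonzero space that are supported on the complement of a
projection. -/
theorem exists_kraus_compl {x a : ℕ} (hx : 0 < x) {E : Matrix (Fin a) (Fin a) ℂ} (hE : Eᴴ = E)
    (hEE : E * E = E) : ∃ R : Fin a → Matrix (Fin x) (Fin a) ℂ,
      E + ∑ j, (R j)ᴴ * R j = 1 ∧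
        ∀ {β : Type} [Fintype β] (M : Matrix (Fin a) β ℂ), E * M = M → ∀ j, R j * M = 0 := by
  -- The `j`-th operator writes row `j` of `1 - E` into the first coordinate of the target, so any
  -- nonzero dimension suffices.
  refine ⟨fun j => of fun p q => if p = ⟨0, hx⟩ then (1 - E) j q else 0, ?_, fun M hM j => ?_⟩
  · have h1 : (1 - E)ᴴ * (1 - E) = 1 - E := by
      rw [conjTranspose_sub, hE, conjTranspose_one, Matrix.mul_sub, Matrix.sub_mul,
        Matrix.sub_mul, hEE]
      simp
    have h2 : ∑ j, (of fun (p : Fin x) q => if p = ⟨0, hx⟩ then (1 - E) j q else 0)ᴴ *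
        (of fun (p : Fin x) q => if p = ⟨0, hx⟩ then (1 - E) j q else 0) = (1 - E)ᴴ * (1 - E) := by
      ext q r
      rw [Matrix.sum_apply, mul_apply]
      refine Finset.sum_congr rfl fun j _ => ?_
      rw [mul_apply, Finset.sum_eq_single ⟨0, hx⟩]
      · simp [conjTranspose_apply]
      · intro p _ hp
        simp [hp]
      · simp
    rw [h2, h1, add_sub_cancel]
  · have h0 : (1 - E) * M = 0 := by rw [Matrix.sub_mul, hM, Matrix.one_mul, sub_self]
    ext p q
    rw [mul_apply]
    by_cases hp : p = ⟨0, hx⟩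
    · simpa [hp, mul_apply] using congrFun₂ h0 j q
    · simp [hp]

/-- Bob applies a partial isometry to a state in its initial space. -/
theorem exists_isLOCC_bob {x y b : ℕ} (hy : 0 < y) (L : Matrix (Fin y) (Fin b) ℂ)
    (hL : Lᴴ * L * (Lᴴ * L) = Lᴴ * L) : ∃ Λ, IsLOCC x y x b Λ ∧
      ∀ M : Matrix (Fin x) (Fin b) ℂ, Lᴴ * L * Mᵀ = Mᵀ → Λ (outer M) = outer (M * Lᵀ) := by
  obtain ⟨R, hR, hRM⟩ := exists_kraus_compl hy
    (show (Lᴴ * L)ᴴ = Lᴴ * L by rw [conjTranspose_mul, conjTranspose_conjTranspose]) hL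
  refine ⟨_, IsLOCC.bob_fintype (τ := Option (Fin b)) (b' := fun _ => y)
    (K := fun m => m.elim L R) ?_ fun _ => IsLOCC.done, fun M hM => ?_⟩
  · rw [Fintype.sum_option]
    exact hR
  · rw [LinearMap.sum_apply, Fintype.sum_option]
    simp only [LinearMap.comp_apply, conjBy_one_kronecker_outer, LinearMap.id_apply,
      Option.elim_none, Option.elim_some]
    rw [add_eq_left]
    refine Finset.sum_eq_zero fun j _ => ?_
    rw [show M * (R j)ᵀ = (R j * Mᵀ)ᵀ by rw [transpose_mul, transpose_transpose], hRM _ hM,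
      transpose_zero, outer_zero]

/-- A one-way protocol: Alice measures, and Bob applies a partial isometry that depends on the
outcome. -/
theorem exists_isLOCC_oneWay {x y a b : ℕ} (hx : 0 < x) (hy : 0 < y) {τ : Type*} [Fintype τ]
    {M : Matrix (Fin a) (Fin b) ℂ} {N : Matrix (Fin x) (Fin y) ℂ}
    {K : τ → Matrix (Fin x) (Fin a) ℂ} {E : Matrix (Fin a) (Fin a) ℂ} (hE : Eᴴ = E)
    (hEE : E * E = E) (hK : ∑ m, (K m)ᴴ * K m = E) (hEM : E * M = M)
    {L : τ → Matrix (Fin y) (Fin b) ℂ}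
    (hL : ∀ m, (L m)ᴴ * L m * ((L m)ᴴ * L m) = (L m)ᴴ * L m)
    (hLM : ∀ m, (L m)ᴴ * L m * (K m * M)ᵀ = (K m * M)ᵀ) {c : τ → ℂ}
    (hKL : ∀ m, K m * M * (L m)ᵀ = c m • N) (hc : ∑ m, c m * star (c m) = 1) :
    ∃ Λ, IsLOCC x y a b Λ ∧ Λ (outer M) = outer N := by
  obtain ⟨R, hR, hRM⟩ := exists_kraus_compl hx hE hEE
  choose Λ hΛ hΛM using fun m => exists_isLOCC_bob (x := x) hy (L m) (hL m)
  -- The outcomes in `R` have probability zero on `M`, but their branches must still end in the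
  -- right dimensions; any protocol will do.
  obtain ⟨Λ', hΛ', -⟩ := exists_isLOCC_bob (x := x) hy (0 : Matrix (Fin y) (Fin b) ℂ) (by simp)
  refine ⟨_, IsLOCC.alice_fintype (τ := τ ⊕ Fin a) (a' := fun _ => x) (K := Sum.elim K R)
    (Λ := Sum.elim Λ fun _ => Λ') ?_ ?_, ?_⟩
  · rw [Fintype.sum_sum_type]
    simp only [Sum.elim_inl, Sum.elim_inr]
    rw [hK, hR]
  · rintro (m | j)
    · exact hΛ m
    · exact hΛ'
  · rw [LinearMap.sum_apply, Fintype.sum_sum_type]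
    simp only [LinearMap.comp_apply, conjBy_kronecker_one_outer, Sum.elim_inl, Sum.elim_inr]
    simp only [fun m => hΛM m _ (hLM m), fun j => hRM M hEM j, outer_zero, map_zero,
      Finset.sum_const_zero, add_zero, hKL, outer_smul]
    rw [← Finset.sum_smul, hc, one_smul]

/-- If the Schmidt vector of `M` is a convex combination of Schmidt vectors of `N`, then `M` can
be transformed into `N`. -/
theorem exists_isLOCC_of_convex {x y a b : ℕ} (hx : 0 < x) (hy : 0 < y)
    {M : Matrix (Fin a) (Fin b) ℂ} {N : Matrix (Fin x) (Fin y) ℂ} {ι τ : Type*} [Fintype ι]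
    [DecidableEq ι] [Fintype τ] {u : ι → ℝ} {v : τ → ι → ℝ} {p : τ → ℝ} (hu : HasSchmidt M u)
    (hv : ∀ m, HasSchmidt N (v m)) (hp : ∀ m, 0 ≤ p m) (hp1 : ∑ m, p m = 1)
    (huv : ∀ i, u i = ∑ m, p m * v m i) : ∃ Λ, IsLOCC x y a b Λ ∧ Λ (outer M) = outer N := by
  obtain ⟨hu0, U, V, hU, hV, rfl⟩ := hu
  choose hv0 U' V' hU' hV' hN using hv
  have hV₁ : Vᵀ * Vᵀᴴ = suppProj u := by
    have : Vᵀ * Vᵀᴴ = (Vᴴ * V)ᵀ := by rw [transpose_mul]; rfl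
    rw [this, hV, transpose_suppProj]
  have hUS := mul_suppProj_of_gram hU
  have hVS := mul_suppProj_of_gram hV
  have hSU : suppProj u * Uᴴ = Uᴴ := by
    rw [← conjTranspose_suppProj, ← conjTranspose_mul, hUS]
  have hSV : suppProj u * Vᵀ = Vᵀ := by
    rw [← transpose_suppProj, ← transpose_mul, hVS]
  have hcomm : ∀ m, suppProj (v m) * suppProj u = suppProj u * suppProj (v m) := by
    intro m
    simp only [suppProj, diagonal_mul_diagonal, mul_comm]
  -- If `u i = 0`, then every `p m * v m i` vanishes. The factor `√(p m)` is needed because a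
  -- permutation of weight zero may leave the support of `u`.
  have hsupp : ∀ m, (Real.sqrt (p m) : ℂ) • (sqrtDiag (v m) * suppProj u) =
      (Real.sqrt (p m) : ℂ) • sqrtDiag (v m) := by
    intro m
    rw [sqrtDiag, suppProj, diagonal_mul_diagonal, ← diagonal_smul, ← diagonal_smul]
    congr 1
    ext i
    simp only [Pi.smul_apply, smul_eq_mul]
    split_ifs with h
    · rw [huv, Finset.sum_eq_zero_iff_of_nonneg fun m _ => mul_nonneg (hp m) (hv0 m i)] at h
      have := h m (Finset.mem_univ m)
      rw [← Complex.ofReal_mul, ← Real.sqrt_mul (hp m), this]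
      simp
    · rw [mul_one]
  -- Alice rescales the Schmidt coefficients from `u` to `p m * v m` and rotates her basis to that
  -- of `N`; Bob's `L m` then rotates his. The convex combination is exactly the completeness
  -- relation on the support of Alice's state.
  let K : τ → Matrix (Fin x) (Fin a) ℂ := fun m =>
    (Real.sqrt (p m) : ℂ) • (U' m * (sqrtDiag (v m) * (invSqrtDiag u * Uᴴ)))
  let L : τ → Matrix (Fin y) (Fin b) ℂ := fun m => V' m * Vᴴ
  have hKM : ∀ m, K m * (U * sqrtDiag u * Vᵀ) =
      (Real.sqrt (p m) : ℂ) • (U' m * (sqrtDiag (v m) * Vᵀ)) := by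
    intro m
    simp only [K, Matrix.smul_mul, Matrix.mul_assoc]
    rw [← Matrix.mul_assoc Uᴴ, hU, ← Matrix.mul_assoc (suppProj u), suppProj_mul_sqrtDiag,
      ← Matrix.mul_assoc (invSqrtDiag u), invSqrtDiag_mul_sqrtDiag hu0, hSV]
  have hLL : ∀ m, (L m)ᴴ * L m = V * suppProj (v m) * Vᴴ := by
    intro m
    simp only [L, conjTranspose_mul, conjTranspose_conjTranspose]
    rw [Matrix.mul_assoc, ← Matrix.mul_assoc (V' m)ᴴ, hV', Matrix.mul_assoc]
  refine exists_isLOCC_oneWay hx hy (K := K) (L := L) (E := U * Uᴴ)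
    (c := fun m => (Real.sqrt (p m) : ℂ)) ?_ ?_ ?_ ?_ ?_ ?_ ?_ ?_
  · rw [conjTranspose_mul, conjTranspose_conjTranspose]
  · rw [← Matrix.mul_assoc, mul_conjTranspose_mul_of_gram hU]
  · have h1 : ∀ m, (K m)ᴴ * K m = U * (invSqrtDiag u *
        ((p m : ℂ) • (sqrtDiag (v m) * sqrtDiag (v m))) * invSqrtDiag u) * Uᴴ := by
      intro m
      simp only [K, conjTranspose_smul, conjTranspose_mul, conjTranspose_conjTranspose,
        conjTranspose_sqrtDiag, conjTranspose_invSqrtDiag, Matrix.smul_mul, Matrix.mul_smul,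
        smul_smul, Matrix.mul_assoc]
      rw [← Matrix.mul_assoc (U' m)ᴴ, hU', ← Matrix.mul_assoc (suppProj (v m)),
        suppProj_mul_sqrtDiag, RCLike.star_def, Complex.conj_ofReal, ← Complex.ofReal_mul,
        Real.mul_self_sqrt (hp m)]
    have h2 : ∑ m, (p m : ℂ) • (sqrtDiag (v m) * sqrtDiag (v m)) = sqrtDiag u * sqrtDiag u := by
      rw [sqrtDiag_mul_self hu0]
      simp only [fun m => sqrtDiag_mul_self (hv0 m)]
      ext i j
      by_cases hij : i = j
      · subst hij
        simp [Matrix.sum_apply, huv]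
      · simp [Matrix.sum_apply, hij]
    simp only [h1]
    rw [← Matrix.sum_mul, ← Matrix.mul_sum, ← Matrix.sum_mul, ← Matrix.mul_sum, h2,
      ← Matrix.mul_assoc (invSqrtDiag u), invSqrtDiag_mul_sqrtDiag hu0, Matrix.mul_assoc
      (suppProj u), sqrtDiag_mul_invSqrtDiag hu0, suppProj_mul_self, hUS]
  · simp only [← Matrix.mul_assoc]
    rw [mul_conjTranspose_mul_of_gram hU]
  · intro m
    rw [hLL]
    calc _ = V * (suppProj (v m) * (Vᴴ * V) * suppProj (v m)) * Vᴴ := by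
          simp only [Matrix.mul_assoc]
      _ = V * suppProj u * (suppProj (v m) * suppProj (v m)) * Vᴴ := by
          rw [hV, hcomm]
          simp only [Matrix.mul_assoc]
      _ = _ := by rw [hVS, suppProj_mul_self]
  · intro m
    rw [hLL, hKM, transpose_smul, Matrix.mul_smul, transpose_mul, transpose_mul,
      transpose_transpose, transpose_sqrtDiag]
    congr 1
    calc _ = V * (suppProj (v m) * (Vᴴ * V) * sqrtDiag (v m)) * (U' m)ᵀ := by
          simp only [Matrix.mul_assoc]
      _ = V * suppProj u * (suppProj (v m) * sqrtDiag (v m)) * (U' m)ᵀ := by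
          rw [hV, hcomm]
          simp only [Matrix.mul_assoc]
      _ = _ := by rw [hVS, suppProj_mul_sqrtDiag]
  · intro m
    rw [hKM, Matrix.smul_mul]
    calc _ = U' m * ((Real.sqrt (p m) : ℂ) • (sqrtDiag (v m) * (Vᵀ * Vᵀᴴ))) * (V' m)ᵀ := by
          simp only [L, transpose_mul, Matrix.mul_smul, Matrix.smul_mul, Matrix.mul_assoc]
          rfl
      _ = _ := by
          rw [hV₁, hsupp, Matrix.mul_smul, Matrix.smul_mul, ← hN]
  · rw [← Complex.ofReal_one, ← hp1, Complex.ofReal_sum]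
    refine Finset.sum_congr rfl fun m _ => ?_
    rw [RCLike.star_def, Complex.conj_ofReal, ← Complex.ofReal_mul, Real.mul_self_sqrt (hp m)]

/-- The other half of Nielsen's theorem: majorization suffices for an LOCC transformation of pure
states. -/
theorem Majorized.exists_isLOCC {x y a b : ℕ} {M : Matrix (Fin a) (Fin b) ℂ}
    {N : Matrix (Fin x) (Fin y) ℂ} (hM : (Mᴴ * M).trace = 1) (hN : (Nᴴ * N).trace = 1)
    {ι κ : Type*} [Fintype ι] [Fintype κ] [DecidableEq ι] [DecidableEq κ] {u : ι → ℝ} {v : κ → ℝ}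
    (hu : HasSchmidt M u) (hv : HasSchmidt N v) (h : Majorized u v) :
    ∃ Λ, IsLOCC x y a b Λ ∧ Λ (outer M) = outer N := by
  have hx : 0 < x := by
    rcases Nat.eq_zero_or_pos x with rfl | hx
    · simp [trace] at hN
    · exact hx
  have hy : 0 < y := by
    rcases Nat.eq_zero_or_pos y with rfl | hy
    · simp [trace] at hN
    · exact hy
  have hu1 : ∑ i, u i = 1 := by
    rw [hu.trace_eq] at hM
    exact_mod_cast hM
  have hv1 : ∑ i, v i = 1 := by
    rw [hv.trace_eq] at hN
    exact_mod_cast hN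
  have hu' := hu.sumElim_zero (κ := κ)
  have hv' := hv.zero_sumElim (κ := ι)
  obtain ⟨p, hp, hp1, hpw⟩ := h.sumElim.exists_weights hv'.1 (by simp [hu1, hv1])
  exact exists_isLOCC_of_convex hx hy hu' (fun σ : Equiv.Perm (ι ⊕ κ) => hv'.comp_equiv σ) hp hp1
    hpw

/-! ### Schmidt vectors of bipartite states -/

theorem trace_conjTranspose_mul_self_eq_norm {α β : Type*} [Fintype α] [Fintype β]
    (M : Matrix α β ℂ) :
    (Mᴴ * M).trace = ((‖WithLp.toLp 2 fun i : α × β => M i.1 i.2‖ ^ 2 : ℝ) : ℂ) := by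
  rw [EuclideanSpace.norm_sq_eq, Fintype.sum_prod_type, Finset.sum_comm, trace,
    Complex.ofReal_sum]
  exact Finset.sum_congr rfl fun j _ => (sum_norm_sq_col M j).symm

/-- `x` is a vector of squared Schmidt coefficients of the state `ψ`. -/
def BipartiteState.HasSchmidtVec (ψ : BipartiteState) {ι : Type*} [Fintype ι] [DecidableEq ι]
    (x : ι → ℝ) : Prop :=
  ∃ (v : UnitVec (Fin ψ.dimA × Fin ψ.dimB)), ψ.state = Quotient.mk _ v ∧
    HasSchmidt (of fun i j => v.1 (i, j)) x

theorem BipartiteState.exists_hasSchmidtVec (ψ : BipartiteState) :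
    ∃ x : Fin ψ.dimA → ℝ, ψ.HasSchmidtVec x := by
  obtain ⟨v, hv⟩ := Quotient.exists_rep ψ.state
  obtain ⟨x, hx⟩ := exists_hasSchmidt (of fun i j => v.1 (i, j))
  exact ⟨x, v, hv.symm, hx⟩

theorem UnitVec.trace_eq_one {a b : ℕ} (v : UnitVec (Fin a × Fin b)) :
    ((of fun i j => v.1 (i, j))ᴴ * (of fun i j => v.1 (i, j))).trace = 1 := by
  rw [trace_conjTranspose_mul_self_eq_norm]
  have : (WithLp.toLp 2 fun i : Fin a × Fin b =>
      (of fun i j => v.1 (i, j) : Matrix (Fin a) (Fin b) ℂ) i.1 i.2) = v.1 := rfl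
  rw [this, v.2]
  simp

theorem BipartiteState.HasSchmidtVec.sum_eq_one {ψ : BipartiteState} {ι : Type*} [Fintype ι]
    [DecidableEq ι] {x : ι → ℝ} (h : ψ.HasSchmidtVec x) : ∑ i, x i = 1 := by
  obtain ⟨v, -, hx⟩ := h
  have := hx.trace_eq
  rw [v.trace_eq_one] at this
  exact_mod_cast this.symm

theorem BipartiteState.HasSchmidtVec.nonneg {ψ : BipartiteState} {ι : Type*} [Fintype ι]
    [DecidableEq ι] {x : ι → ℝ} (h : ψ.HasSchmidtVec x) (i : ι) : 0 ≤ x i := by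
  obtain ⟨v, -, hx⟩ := h
  exact hx.1 i

theorem BipartiteState.HasSchmidtVec.tensor {ψ φ : BipartiteState} {ι κ : Type*} [Fintype ι]
    [Fintype κ] [DecidableEq ι] [DecidableEq κ] {x : ι → ℝ} {y : κ → ℝ}
    (hψ : ψ.HasSchmidtVec x) (hφ : φ.HasSchmidtVec y) :
    (ψ.tensor φ).HasSchmidtVec fun p : ι × κ => x p.1 * y p.2 := by
  obtain ⟨v, hv, hx⟩ := hψ
  obtain ⟨w, hw, hy⟩ := hφ
  refine ⟨⟨tensorVec v.1 w.1,
    (norm_tensorVec _ _).trans (by rw [v.2, w.2, one_mul])⟩, ?_, ?_⟩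
  · change ψ.state.tensor φ.state = _
    rw [hv, hw]
    rfl
  · exact (hx.kronecker hy).submatrix finProdFinEquiv.symm finProdFinEquiv.symm

/-- Nielsen's theorem. -/
theorem loccTransforms_iff_majorized {ψ φ : BipartiteState} {ι κ : Type*} [Fintype ι] [Fintype κ]
    [DecidableEq ι] [DecidableEq κ] {x : ι → ℝ} {y : κ → ℝ} (hψ : ψ.HasSchmidtVec x)
    (hφ : φ.HasSchmidtVec y) : LOCCTransforms ψ φ ↔ Majorized x y := by
  obtain ⟨v, hv, hx⟩ := hψ
  obtain ⟨w, hw, hy⟩ := hφ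
  have e1 : ψ.state.density = outer (of fun i j => v.1 (i, j)) := by
    rw [hv]
    rfl
  have e2 : φ.state.density = outer (of fun i j => w.1 (i, j)) := by
    rw [hw]
    rfl
  rw [LOCCTransforms, e1, e2]
  constructor
  · rintro ⟨Λ, hΛ, h⟩
    exact hΛ.majorized w.trace_eq_one h hx hy
  · exact Majorized.exists_isLOCC v.trace_eq_one w.trace_eq_one hx hy

/-- Every probability vector is a Schmidt vector. -/
theorem exists_bipartiteState_hasSchmidtVec {ι : Type*} [Fintype ι] [DecidableEq ι] {x : ι → ℝ}
    (hx : ∀ i, 0 ≤ x i) (h1 : ∑ i, x i = 1) : ∃ ψ : BipartiteState, ψ.HasSchmidtVec x := by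
  let e := (Fintype.equivFin ι).symm
  have hS : HasSchmidt ((sqrtDiag x).submatrix e e) x := (hasSchmidt_sqrtDiag hx).submatrix e e
  let v : EuclideanSpace ℂ (Fin (Fintype.card ι) × Fin (Fintype.card ι)) :=
    WithLp.toLp 2 fun i => (sqrtDiag x).submatrix e e i.1 i.2
  have hv : ‖v‖ = 1 := by
    have h := hS.trace_eq
    rw [trace_conjTranspose_mul_self_eq_norm, h1, Complex.ofReal_inj] at h
    exact (pow_eq_one_iff_of_nonneg (norm_nonneg _) two_ne_zero).1 h
  exact ⟨⟨_, _, Quotient.mk _ ⟨v, hv⟩⟩, ⟨v, hv⟩, rfl, hS⟩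

/-! ### Flexible catalysis and single catalysts -/

theorem cat_subset_finFlexCat {T : Type*} (op : T → T → T) (le : T → T → Prop) :
    cat op le ⊆ finFlexCat op le := by
  intro p hp
  obtain ⟨C, hC⟩ := Set.mem_iUnion.1 hp
  refine Set.mem_biUnion (x := {C}) ⟨Set.singleton_nonempty C, Set.finite_singleton C⟩ ?_
  rintro _ rfl
  exact ⟨_, rfl, hC⟩

/-- By pigeonhole an orbit repeats, and the first of two coinciding iterates is periodic. -/
theorem nonempty_periodicPts {α : Type*} [Finite α] [Nonempty α] (f : α → α) :
    (Function.periodicPts f).Nonempty := by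
  obtain ⟨x⟩ := ‹Nonempty α›
  obtain ⟨m, n, hmn, h⟩ := Finite.exists_ne_map_eq_of_infinite fun n : ℕ => f^[n] x
  wlog hlt : m < n generalizing m n
  · exact this n m hmn.symm h.symm (by omega)
  refine ⟨f^[m] x, n - m, by omega, ?_⟩
  rw [Function.IsPeriodicPt, Function.IsFixedPt, ← Function.iterate_add_apply,
    Nat.sub_add_cancel hlt.le]
  exact h.symm

/-- A cyclic family of transformations, catalyzed by the direct sum of the family. -/
theorem mem_cat_of_equiv {A B : BipartiteState} {τ : Type*} [Fintype τ] [Nonempty τ]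
    (C : τ → BipartiteState) (e : τ ≃ τ)
    (h : ∀ t, LOCCTransforms (A.tensor (C t)) (B.tensor (C (e t)))) :
    (A, B) ∈ cat BipartiteState.tensor LOCCTransforms := by
  classical
  obtain ⟨x, hx⟩ := A.exists_hasSchmidtVec
  obtain ⟨y, hy⟩ := B.exists_hasSchmidtVec
  choose z hz using fun t => (C t).exists_hasSchmidtVec
  have hcard : (Fintype.card τ : ℝ) ≠ 0 := by
    exact_mod_cast Fintype.card_ne_zero
  -- Uniform weights are what makes the direct sum invariant under permuting the summands by `e`.
  obtain ⟨D, hD⟩ := exists_bipartiteState_hasSchmidtVec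
    (x := fun p : Σ t, Fin (C t).dimA => (Fintype.card τ : ℝ)⁻¹ * z p.1 p.2)
    (fun p => mul_nonneg (by positivity) ((hz _).nonneg _)) (by
      rw [← Finset.mul_sum, Fintype.sum_sigma]
      simp only [fun t => (hz t).sum_eq_one]
      simp [hcard])
  refine Set.mem_iUnion.2 ⟨D, ?_⟩
  change LOCCTransforms (A.tensor D) (B.tensor D)
  rw [loccTransforms_iff_majorized (hx.tensor hD) (hy.tensor hD)]
  exact Majorized.mul_sigma (by positivity) e fun t =>
    (loccTransforms_iff_majorized (hx.tensor (hz t)) (hy.tensor (hz (e t)))).1 (h t)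

/-- A choice of successor catalysts is a self-map of a finite nonempty set and restricts to a
bijection of its periodic points. Several disjoint cycles do no harm, since only bijectivity
matters. -/
theorem finFlexCat_subset_cat :
    finFlexCat BipartiteState.tensor LOCCTransforms ⊆
      cat BipartiteState.tensor LOCCTransforms := by
  rintro ⟨A, B⟩ hAB
  obtain ⟨S, ⟨hne, hfin⟩, hS⟩ := Set.mem_iUnion₂.1 hAB
  choose f hf hAf using hS
  let g : S → S := fun C => ⟨f C.1 C.2, hf C.1 C.2⟩
  have := hfin.to_subtype
  have := hne.to_subtype
  have := (nonempty_periodicPts g).to_subtype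
  have := Fintype.ofFinite (Function.periodicPts g)
  exact mem_cat_of_equiv (fun t : Function.periodicPts g => t.1.1)
    ((Function.bijOn_periodicPts g).equiv g) fun t => hAf t.1.1 t.1.2

end

end FlexCat

theorem theorem5p4 :
    FlexCat.finFlexCat FlexCat.BipartiteState.tensor FlexCat.LOCCTransforms =
      FlexCat.cat FlexCat.BipartiteState.tensor FlexCat.LOCCTransforms := by
  exact FlexCat.finFlexCat_subset_cat.antisymm (FlexCat.cat_subset_finFlexCat _ _)
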